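/- **Setting.** Let $\mathbb F\in\{\mathbb R,\mathbb C\}$, $k\ge 1$, and let $A-\lambda B$ with $A,B\in\mathbb F^{n\times n}$ be a singular pencil of normal rank $\max_\zeta \operatorname{rank}(A-\zeta B)=n-k$. Let $\lambda_i\in\mathbb F$ be a finite simple eigenvalue, that is, a simple root of $\det R(\lambda)$, where $R(\lambda)$ is the regular part of the (complex) Kronecker canonical form of $A-\lambda B$. Let $\mathcal M_{\rm RS}$ be the minimal reducing subspace, i.e. the intersection of all subspaces $\mathcal M\subseteq\mathbb F^n$ with $\dim(A\mathcal M+B\mathcal M)=\dim\mathcal M-k$, and let $\mathcal L_{\rm RS}$ be the same object for $(A^*,B^*)$. Let $X=[X_1\ x]$ and $Y=[Y_1\ y]$ be $n\times(k+1)$ matrices over $\mathbb F$ with orthonormal columns such that the columns of $X_1$, $X$, $Y_1$, $Y$ are bases of $\ker(A-\lambda_iB)\cap\mathcal M_{\rm RS}$, $\ker(A-\lambda_iB)$, $\ker((A-\lambda_iB)^*)\cap\mathcal L_{\rm RS}$, $\ker((A-\lambda_iB)^*)$, respectively. Let $U,V\in\mathbb F^{n\times k}$ be independent random matrices, uniformly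 distributed on the Stiefel manifold $\{Q\in\mathbb F^{n\times k}: Q^*Q=I\}$, let $\tau\in\mathbb F$ be nonzero, and let $D_A,D_B\in\mathbb F^{k\times k}$ be (constant or random) diagonal matrices such that $D_A-\lambda_iD_B$ is almost surely nonsingular. Let $x_i$ and $y_i$ be right and left eigenvectors over $\mathbb F$, of Euclidean norm $1$, for the eigenvalue $\lambda_i$ of the modified pencil $$A-\lambda B+\tau\,(UD_AV^*-\lambda\,UD_BV^*),$$ and put $\alpha_{\mathbb F}=x^*x_i$ and $\beta_{\mathbb F}=y^*y_i$. **Lemma A.1.** Almost surely $V^*x_i=0$, $U^*y_i=0$, and $x_i=X_1a+\alpha_{\mathbb F}\,x$, $y_i=Y_1b+\beta_{\mathbb F}\,y$ for some $a,b\in\mathbb F^k$, so that $\alpha_{\mathbb F}$ and $\beta_{\mathbb F}$ are the last coordinates of $x_i$ and $y_i$ in the bases $X$ and $Y$. Moreover: a) if $\mathbb F=\mathbb C$, then $|\alpha_{\mathbb C}|$ and $|\beta_{\mathbb C}|$ each have the distribution $\mathrm{GB}_1(2,1,1,k)=\mathrm{Kumaraswamy}(2,k)$, with density $h(t;k)=2kt(1-t^2)^{k-1}$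 for $0<t<1$ (and $0$ elsewhere); b) if $\mathbb F=\mathbb R$, then $|\alpha_{\mathbb R}|$ and $|\beta_{\mathbb R}|$ each have the distribution $\mathrm{GB}_1(2,1,\tfrac12,\tfrac k2)$, with density $g(t;k)=\dfrac{2}{\mathrm B(\frac12,\frac k2)}(1-t^2)^{k/2-1}$ for $0<t<1$ (and $0$ elsewhere). Here $\mathrm B(p,q)=\Gamma(p)\Gamma(q)/\Gamma(p+q)$. For $a,b,p,q>0$, $\mathrm{GB}_1(a,b,p,q)$ is the generalized beta distribution of the first kind, with density $\dfrac{a\,t^{ap-1}(1-(t/b)^a)^{q-1}}{b^{ap}\,\mathrm B(p,q)}$ on $(0,b)$; and $\mathrm{Kumaraswamy}(p,q)$ has density $pq\,t^{p-1}(1-t^p)^{q-1}$ on $(0,1)$. -/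

import Mathlib

open MeasureTheory ProbabilityTheory Polynomial

open scoped Matrix ENNReal

noncomputable section

namespace SingularPencil

/-! ### Matrix pencils: normal rank and reducing subspaces -/

section Pencil

variable {𝕜 : Type*} [RCLike 𝕜] {n k : ℕ}

/-- The normal rank `max_ζ rank (A - ζ B)` of the pencil `A - λ B`
(the ranks are bounded by `n`, so the supremum is attained). -/
def normalRank (A B : Matrix (Fin n) (Fin n) 𝕜) : ℕ :=
  ⨆ ζ : 𝕜, (A - ζ • B).rank

/-- `M` is a reducing subspace of `A - λ B`: `dim (A M + B M) = dim M - (n - nrank (A, B))`. -/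
def IsReducing (A B : Matrix (Fin n) (Fin n) 𝕜) (M : Submodule 𝕜 (Fin n → 𝕜)) : Prop :=
  Module.finrank 𝕜 ↥(M.map A.mulVecLin ⊔ M.map B.mulVecLin) + (n - normalRank A B)
    = Module.finrank 𝕜 M

/-- The minimal reducing subspace: the intersection of all reducing subspaces. -/
def minReducing (A B : Matrix (Fin n) (Fin n) 𝕜) : Submodule 𝕜 (Fin n → 𝕜) :=
  sInf {M | IsReducing A B M}

/-- The `n × (k+1)` matrix `X = [X₁ x]` has orthonormal columns, the columns of `X₁` are a basis of
`ker (A - lam B) ∩ M_RS (A, B)`, and the columns of `X` are a basis of `ker (A - lam B)`. -/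
structure IsEigenBasis (A B : Matrix (Fin n) (Fin n) 𝕜) (lam : 𝕜)
    (X₁ : Matrix (Fin n) (Fin k) 𝕜) (x : Fin n → 𝕜) : Prop where
  orthonormal : (Matrix.fromCols X₁ (Matrix.replicateCol Unit x))ᴴ *
    Matrix.fromCols X₁ (Matrix.replicateCol Unit x) = 1
  range_X₁ : LinearMap.range X₁.mulVecLin =
    LinearMap.ker (A - lam • B).mulVecLin ⊓ minReducing A B
  range_X : LinearMap.range (Matrix.fromCols X₁ (Matrix.replicateCol Unit x)).mulVecLin =
    LinearMap.ker (A - lam • B).mulVecLin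

/-- `v` is a right eigenvector of `A - λ B` for `lam`, of Euclidean norm one. -/
def IsUnitEigenvector (A B : Matrix (Fin n) (Fin n) 𝕜) (lam : 𝕜) (v : Fin n → 𝕜) : Prop :=
  (A - lam • B) *ᵥ v = 0 ∧ ‖WithLp.toLp 2 v‖ = 1

end Pencil

/-! ### Kronecker canonical form over `ℂ` and simple eigenvalues -/

/-- The `d × d` Jordan block with eigenvalue `μ`. -/
def jordanBlock (μ : ℂ) (d : ℕ) : Matrix (Fin d) (Fin d) ℂ :=
  Matrix.of fun i j => if j = i then μ else if (j : ℕ) = i + 1 then 1 else 0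

/-- The singular block `L_j(λ) = [0 I_j] - λ [I_j 0]`, of size `j × (j + 1)`. -/
def singularBlock (j : ℕ) : Matrix (Fin j) (Fin (j + 1)) ℂ[X] :=
  Matrix.of fun a b => (if b = a.succ then 1 else 0) - (if b = a.castSucc then X else 0)

/-- The pencil `A - λ B` as a polynomial matrix in the variable `λ`. -/
def polyPencil {m m' : Type*} (A B : Matrix m m' ℂ) : Matrix m m' ℂ[X] :=
  A.map C - (X : ℂ[X]) • B.map C

/-- A Kronecker canonical form of `A - λ B`:
`P (A - λ B) Q = diag (R(λ), S(λ))` with `P, Q` nonsingular, up to the labelling of the rows and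
columns of the right-hand side by `rowEquiv` and `colEquiv`. -/
structure KroneckerForm {n : ℕ} (A B : Matrix (Fin n) (Fin n) ℂ) where
  /-- the number of finite Jordan blocks, their eigenvalues and sizes -/
  numFin : ℕ
  eig : Fin numFin → ℂ
  sizeFin : Fin numFin → ℕ
  /-- the number and the sizes of the nilpotent Jordan blocks -/
  numInf : ℕ
  sizeInf : Fin numInf → ℕ
  /-- the right minimal indices -/
  numRight : ℕ
  rightIdx : Fin numRight → ℕ
  /-- the left minimal indices -/
  numLeft : ℕ
  leftIdx : Fin numLeft → ℕ
  rowEquiv : Fin n ≃ ((Σ i, Fin (sizeFin i)) ⊕ (Σ i, Fin (sizeInf i))) ⊕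
    ((Σ i, Fin (rightIdx i)) ⊕ (Σ i, Fin (leftIdx i + 1)))
  colEquiv : Fin n ≃ ((Σ i, Fin (sizeFin i)) ⊕ (Σ i, Fin (sizeInf i))) ⊕
    ((Σ i, Fin (rightIdx i + 1)) ⊕ (Σ i, Fin (leftIdx i)))
  P : Matrix (Fin n) (Fin n) ℂ
  Q : Matrix (Fin n) (Fin n) ℂ
  isUnit_P : IsUnit P
  isUnit_Q : IsUnit Q
  eq_form : P.map C * polyPencil A B * Q.map C =
    (Matrix.fromBlocks
      (Matrix.fromBlocks
        (polyPencil (Matrix.blockDiagonal' fun i => jordanBlock (eig i) (sizeFin i)) 1) 0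
        0 (polyPencil 1 (Matrix.blockDiagonal' fun i => jordanBlock 0 (sizeInf i))))
      0 0
      (Matrix.fromBlocks
        (Matrix.blockDiagonal' fun i => singularBlock (rightIdx i)) 0
        0 (Matrix.blockDiagonal' fun i => (singularBlock (leftIdx i))ᵀ))).submatrix
      rowEquiv colEquiv

/-- The regular part `R(λ) = diag (J - λ I, I - λ N)` of a Kronecker canonical form. -/
def KroneckerForm.regularPart {n : ℕ} {A B : Matrix (Fin n) (Fin n) ℂ} (K : KroneckerForm A B) :
    Matrix ((Σ i, Fin (K.sizeFin i)) ⊕ (Σ i, Fin (K.sizeInf i)))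
      ((Σ i, Fin (K.sizeFin i)) ⊕ (Σ i, Fin (K.sizeInf i))) ℂ[X] :=
  Matrix.fromBlocks
    (polyPencil (Matrix.blockDiagonal' fun i => jordanBlock (K.eig i) (K.sizeFin i)) 1) 0
    0 (polyPencil 1 (Matrix.blockDiagonal' fun i => jordanBlock 0 (K.sizeInf i)))

/-- `lam` is a finite simple eigenvalue of the complex pencil `A - λ B`: it is a simple root of
`det R(λ)`. (Up to a nonzero constant, `det R(λ)` does not depend on the canonical form.) -/
def IsSimpleEigenvalue {n : ℕ} (A B : Matrix (Fin n) (Fin n) ℂ) (lam : ℂ) : Prop :=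
  ∃ K : KroneckerForm A B, K.regularPart.det.rootMultiplicity lam = 1

/-! ### The uniform distribution on the Stiefel manifold -/

section Stiefel

variable {𝕜 : Type*} [RCLike 𝕜]

/-- The σ-algebra on matrices: the product σ-algebra of the entries. -/
instance instMeasurableSpaceMatrix {m m' R : Type*} [MeasurableSpace R] :
    MeasurableSpace (Matrix m m' R) :=
  inferInstanceAs (MeasurableSpace (m → m' → R))

instance instBorelSpaceMatrix {m m' R : Type*} [Countable m] [Countable m'] [TopologicalSpace R]
    [SecondCountableTopology R] [MeasurableSpace R] [BorelSpace R] :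
    BorelSpace (Matrix m m' R) :=
  inferInstanceAs (BorelSpace (m → m' → R))

instance instCompactSpaceUnitaryGroup (n : ℕ) :
    CompactSpace (Matrix.unitaryGroup (Fin n) 𝕜) := by
  refine isCompact_iff_compactSpace.mp ?_
  have hc : IsClosed (Matrix.unitaryGroup (Fin n) 𝕜 : Set (Matrix (Fin n) (Fin n) 𝕜)) :=
    isClosed_unitary
  have hK : IsCompact (Set.univ.pi fun _ : Fin n => Set.univ.pi fun _ : Fin n =>
      Metric.closedBall (0 : 𝕜) 1) :=
    isCompact_univ_pi fun _ => isCompact_univ_pi fun _ => isCompact_closedBall _ _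
  refine hK.of_isClosed_subset hc fun W hW => ?_
  simp only [Set.mem_pi, Set.mem_univ, forall_true_left, mem_closedBall_zero_iff]
  exact fun i j => entry_norm_bound_of_unitary hW i j

/-- The first `k` columns of a square matrix: `W ↦ W [e₁ … e_k]`. -/
def firstCols {n : ℕ} (k : ℕ) (W : Matrix (Fin n) (Fin n) 𝕜) : Matrix (Fin n) (Fin k) 𝕜 :=
  W * Matrix.of fun (i : Fin n) (j : Fin k) => if (i : ℕ) = j then (1 : 𝕜) else 0

/-- The Haar probability measure on the group of unitary (orthogonal if `𝕜 = ℝ`) matrices. -/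
def haarUnitary (𝕜 : Type*) [RCLike 𝕜] (n : ℕ) : Measure (Matrix.unitaryGroup (Fin n) 𝕜) :=
  Measure.haarMeasure ⊤

/-- For `k ≤ n`, the uniform distribution on the Stiefel manifold
`{Q ∈ 𝕜^{n × k} | Qᴴ Q = 1}`, i.e. the unique probability measure there that is invariant under
left multiplication by unitary matrices, realized as the law of the first `k` columns of a Haar distributed
unitary matrix. -/
def stiefelUniform (𝕜 : Type*) [RCLike 𝕜] (n k : ℕ) : Measure (Matrix (Fin n) (Fin k) 𝕜) :=
  (haarUnitary 𝕜 n).map fun W : Matrix.unitaryGroup (Fin n) 𝕜 => firstCols k (W : Matrix (Fin n) (Fin n) 𝕜)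

end Stiefel

/-! ### The two distributions -/

/-- The density of the generalized beta distribution of the first kind `GB₁(a, b, p, q)`, for
`a, b, p, q > 0`. -/
def gb1PDFReal (a b p q x : ℝ) : ℝ :=
  if 0 < x ∧ x < b then
    a * x ^ (a * p - 1) * (1 - (x / b) ^ a) ^ (q - 1) / (b ^ (a * p) * beta p q)
  else 0

/-- The generalized beta distribution of the first kind. -/
def gb1Measure (a b p q : ℝ) : Measure ℝ :=
  volume.withDensity fun x => ENNReal.ofReal (gb1PDFReal a b p q x)

/-- The density of the Kumaraswamy distribution, for `p, q > 0`. -/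
def kumaraswamyPDFReal (p q x : ℝ) : ℝ :=
  if 0 < x ∧ x < 1 then p * q * x ^ (p - 1) * (1 - x ^ p) ^ (q - 1) else 0

/-- The Kumaraswamy distribution with parameters `p` and `q`. -/
def kumaraswamyMeasure (p q : ℝ) : Measure ℝ :=
  volume.withDensity fun x => ENNReal.ofReal (kumaraswamyPDFReal p q x)

/-! ### The randomly modified pencil -/

section Setting

variable {𝕜 : Type*} [RCLike 𝕜] {n k : ℕ}

/-- `A + τ U D Vᴴ` with `D` diagonal: applied to `(A, D_A)` and `(B, D_B)` it gives the two
coefficients of the modified pencil `A - λ B + τ (U D_A Vᴴ - λ U D_B Vᴴ)`. -/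
def modified (A : Matrix (Fin n) (Fin n) 𝕜) (τ : 𝕜) (U V : Matrix (Fin n) (Fin k) 𝕜)
    (d : Fin k → 𝕜) : Matrix (Fin n) (Fin n) 𝕜 :=
  A + τ • (U * Matrix.diagonal d * Vᴴ)

/-- The standing setting. A pencil `A - λ B` over `𝕜` of normal rank `n - k`, `k ≥ 1`, with a finite
simple eigenvalue `lam ∈ 𝕜`; the orthonormal bases `[X₁ x]` and `[Y₁ y]` of the right and left null
spaces at `lam`; independent `U`, `V`, uniform on the Stiefel manifold; diagonal `D_A`, `D_B`,
constant or random, such that `lam` is almost surely not an eigenvalue of `D_A - λ D_B` (so that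
this pencil is regular); and normalized right and left eigenvectors `xi`, `yi` of the modified
pencil for `lam`. -/
structure Setting {Ω : Type*} [MeasurableSpace Ω] (P : Measure Ω)
    (A B : Matrix (Fin n) (Fin n) 𝕜) (lam : 𝕜)
    (X₁ : Matrix (Fin n) (Fin k) 𝕜) (x : Fin n → 𝕜)
    (Y₁ : Matrix (Fin n) (Fin k) 𝕜) (y : Fin n → 𝕜)
    (τ : 𝕜) (dA dB : Ω → Fin k → 𝕜) (U V : Ω → Matrix (Fin n) (Fin k) 𝕜)
    (xi yi : Ω → Fin n → 𝕜) : Prop where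
  one_le_k : 1 ≤ k
  normalRank_add : normalRank A B + k = n
  simple : IsSimpleEigenvalue (A.map (RCLike.map 𝕜 ℂ)) (B.map (RCLike.map 𝕜 ℂ))
    (RCLike.map 𝕜 ℂ lam)
  right_basis : IsEigenBasis A B lam X₁ x
  left_basis : IsEigenBasis Aᴴ Bᴴ (star lam) Y₁ y
  tau_ne_zero : τ ≠ 0
  nonsingular : ∀ᵐ ω ∂P,
    (Matrix.diagonal (dA ω) - lam • Matrix.diagonal (dB ω)).det ≠ 0
  law_U : HasLaw U (stiefelUniform 𝕜 n k) P
  law_V : HasLaw V (stiefelUniform 𝕜 n k) P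
  indep : IndepFun U V P
  right_eigenvector : ∀ᵐ ω ∂P, IsUnitEigenvector
    (modified A τ (U ω) (V ω) (dA ω)) (modified B τ (U ω) (V ω) (dB ω)) lam (xi ω)
  left_eigenvector : ∀ᵐ ω ∂P, IsUnitEigenvector
    (modified A τ (U ω) (V ω) (dA ω))ᴴ (modified B τ (U ω) (V ω) (dB ω))ᴴ (star lam) (yi ω)

/-- The coefficient of `v` along the unit vector `u`, i.e. `uᴴ v`. When `[X₁ u]` has orthonormal
columns and `v = X₁ a + c u`, this is `c`. -/
def coeffAlong (u v : Fin n → 𝕜) : 𝕜 := star u ⬝ᵥ v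

end Setting

end SingularPencil

end

/-! Write `C` for the pencil at the eigenvalue, with orthonormal null space bases `X = [X₁ x]` and
`Y = [Y₁ y]`. The modified pencil there is `C + U E Vᴴ`, where `E = τ (D_A - lam D_B)` is almost
surely invertible. Multiplying a null vector equation on the left by `Y₁ᴴ` kills `C` and leaves
`(Y₁ᴴ U) E Vᴴ v = 0`. Since `Y₁ᴴ U` is almost surely invertible
(`ae_det_conjTranspose_mul_stiefelUniform_ne_zero`), `Vᴴ v = 0` and then `C v = 0`. Thus `v = X c`
with `‖c‖ = 1` and `(Vᴴ X) c = 0`. As `Vᴴ X₁` is almost surely invertible, this `k × (k+1)` matrix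
has a kernel line, so `c` is determined up to a phase by `V` alone.

Invariance of the law of `V` under left multiplication by unitaries makes the law of this line
invariant under unitaries of `𝕜^(k+1)`, hence the law of `|⟨u, c⟩|` is the same for every unit `u`.
Averaging over `u` shows that it is the law of `|g_last| / ‖g‖` for `g` uniform in the unit ball
(`measure_ball_mul_lintegral_norm_inner`).

With `d = dim_ℝ 𝕜`, polar coordinates in `𝕜` and in `𝕜^k` give the weight `r^(d-1) s^(dk-1)` on the
quadrant. Planar polar coordinates and `t = cos θ` then give a density proportional to `t^(d-1)
(1-t²)^(dk/2-1)`, that is, `GB₁(2, 1, d/2, dk/2)`. Left eigenvectors follow by taking adjoints,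
which exchanges `U` and `V`. -/

namespace SingularPencil

/-! ### The generalized beta distribution with `a = 2`, `b = 1` -/

/-- The unnormalized density `t ^ (2 p - 1) (1 - t ^ 2) ^ (q - 1)` on `(0, 1)`, as a measure. -/
noncomputable def gb1Shape (p q : ℝ) : Measure ℝ :=
  (volume.restrict (Set.Ioo (0 : ℝ) 1)).withDensity
    fun t => ENNReal.ofReal (t ^ (2 * p - 1) * (1 - t ^ 2) ^ (q - 1))

lemma gb1Measure_eq_restrict (p q : ℝ) :
    gb1Measure 2 1 p q = (volume.restrict (Set.Ioo (0 : ℝ) 1)).withDensity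
      fun t => ENNReal.ofReal (2 * t ^ (2 * p - 1) * (1 - t ^ 2) ^ (q - 1) / beta p q) := by
  rw [gb1Measure, ← withDensity_indicator measurableSet_Ioo]
  congr 1
  ext t
  by_cases ht : t ∈ Set.Ioo (0 : ℝ) 1
  · rw [Set.indicator_of_mem ht, gb1PDFReal, if_pos (Set.mem_Ioo.1 ht)]
    simp
  · rw [Set.indicator_of_notMem ht, gb1PDFReal, if_neg (mt Set.mem_Ioo.2 ht), ENNReal.ofReal_zero]

lemma gb1Measure_eq_smul_gb1Shape {p q : ℝ} (hp : 0 < p) (hq : 0 < q) :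
    gb1Measure 2 1 p q = ENNReal.ofReal (2 / beta p q) • gb1Shape p q := by
  rw [gb1Measure_eq_restrict, gb1Shape, ← withDensity_smul _ (by fun_prop)]
  congr 1
  ext t
  rw [Pi.smul_apply, smul_eq_mul, ← ENNReal.ofReal_mul (by have := beta_pos hp hq; positivity)]
  congr 1
  ring

/-- The substitution `u = t²` turns the density into that of the ordinary beta distribution. Knowing
the total mass lets every later computation leave its constants unevaluated. -/
lemma isProbabilityMeasure_gb1Measure {p q : ℝ} (hp : 0 < p) (hq : 0 < q) :
    IsProbabilityMeasure (gb1Measure 2 1 p q) := by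
  constructor
  rw [gb1Measure_eq_restrict, withDensity_apply _ MeasurableSet.univ, Measure.restrict_univ]
  have himg : (fun t : ℝ => t ^ 2) '' Set.Ioo 0 1 = Set.Ioo 0 1 := by
    ext u
    constructor
    · rintro ⟨t, ⟨h0, h1⟩, rfl⟩
      exact ⟨by positivity, by dsimp only; nlinarith⟩
    · rintro ⟨h0, h1⟩
      refine ⟨√u, ⟨Real.sqrt_pos.2 h0, ?_⟩, Real.sq_sqrt h0.le⟩
      rw [Real.sqrt_lt' one_pos]
      simpa using h1
  have key := lintegral_image_eq_lintegral_abs_deriv_mul (s := Set.Ioo (0 : ℝ) 1)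
    (f := fun t : ℝ => t ^ 2) (f' := fun t => 2 * t) measurableSet_Ioo
    (fun t _ => by simpa using (hasDerivAt_pow 2 t).hasDerivWithinAt)
    (fun s hs t ht h => (sq_eq_sq₀ hs.1.le ht.1.le).1 h)
    (fun u => ENNReal.ofReal (1 / beta p q * u ^ (p - 1) * (1 - u) ^ (q - 1)))
  rw [himg, ← lintegral_betaPDF, lintegral_betaPDF_eq_one hp hq] at key
  rw [key]
  refine setLIntegral_congr_fun measurableSet_Ioo fun t ht => ?_
  have ht0 : 0 < t := ht.1
  rw [← ENNReal.ofReal_mul (abs_nonneg _), abs_of_pos (by positivity : 0 < 2 * t),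
    ← Real.rpow_natCast_mul ht0.le]
  congr 1
  have : t ^ (2 * p - 1) = t * t ^ (((2 : ℕ) : ℝ) * (p - 1)) := by
    nth_rw 2 [← Real.rpow_one t]
    rw [← Real.rpow_add ht0]
    congr 1
    push_cast
    ring
  rw [this]
  ring

/-- A probability measure proportional to `gb1Shape p q` is the generalized beta distribution. -/
lemma eq_gb1Measure_of_eq_smul {p q : ℝ} (hp : 0 < p) (hq : 0 < q) {μ : Measure ℝ}
    [IsProbabilityMeasure μ] {c : ℝ≥0∞} (h : μ = c • gb1Shape p q) : μ = gb1Measure 2 1 p q := by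
  have := isProbabilityMeasure_gb1Measure hp hq
  have h1 : c * gb1Shape p q Set.univ = 1 := by
    rw [← smul_eq_mul, ← Measure.smul_apply, ← h, measure_univ]
  have h2 : ENNReal.ofReal (2 / beta p q) * gb1Shape p q Set.univ = 1 := by
    rw [← smul_eq_mul, ← Measure.smul_apply, ← gb1Measure_eq_smul_gb1Shape hp hq, measure_univ]
  rw [h, gb1Measure_eq_smul_gb1Shape hp hq, ENNReal.eq_inv_of_mul_eq_one_left h1,
    ENNReal.eq_inv_of_mul_eq_one_left h2]

lemma gb1Measure_one_eq_kumaraswamyMeasure {q : ℝ} (hq : 0 < q) :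
    gb1Measure 2 1 1 q = kumaraswamyMeasure 2 q := by
  rw [gb1Measure, kumaraswamyMeasure]
  congr 1
  ext t
  congr 1
  rw [gb1PDFReal, kumaraswamyPDFReal]
  split_ifs with h
  · have hb : beta 1 q = 1 / q := by
      have := (Real.Gamma_pos_of_pos hq).ne'
      rw [beta, Real.Gamma_one, add_comm, Real.Gamma_add_one hq.ne']
      field_simp
    rw [hb]
    simp
    ring
  · rfl

/-- The exponent `k - 1` on the right is a truncated natural subtraction; `1 ≤ k` makes it agree
with the real exponent. -/
lemma kumaraswamyMeasure_two_natCast {k : ℕ} (hk : 1 ≤ k) :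
    kumaraswamyMeasure 2 k = volume.withDensity (fun t : ℝ => ENNReal.ofReal
      ((Set.Ioo (0 : ℝ) 1).indicator
        (fun t => 2 * (k : ℝ) * t * (1 - t ^ 2) ^ (k - 1)) t)) := by
  rw [kumaraswamyMeasure]
  congr 1
  ext t
  congr 1
  by_cases ht : t ∈ Set.Ioo (0 : ℝ) 1
  · rw [Set.indicator_of_mem ht, kumaraswamyPDFReal, if_pos (Set.mem_Ioo.1 ht), ← Nat.cast_pred hk,
      Real.rpow_natCast, Real.rpow_two, (by norm_num : (2 : ℝ) - 1 = 1), Real.rpow_one]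
  · rw [Set.indicator_of_notMem ht, kumaraswamyPDFReal, if_neg (mt Set.mem_Ioo.2 ht)]

lemma gb1Measure_half (q : ℝ) :
    gb1Measure 2 1 (1 / 2) q = volume.withDensity (fun t : ℝ => ENNReal.ofReal
      ((Set.Ioo (0 : ℝ) 1).indicator
        (fun t => 2 / beta (1 / 2) q * (1 - t ^ 2) ^ (q - 1)) t)) := by
  rw [gb1Measure]
  congr 1
  ext t
  congr 1
  by_cases ht : t ∈ Set.Ioo (0 : ℝ) 1
  · rw [Set.indicator_of_mem ht, gb1PDFReal, if_pos (Set.mem_Ioo.1 ht)]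
    simp
    ring
  · rw [Set.indicator_of_notMem ht, gb1PDFReal, if_neg (mt Set.mem_Ioo.2 ht)]

end SingularPencil

namespace SingularPencil

/-! ### Integrals of functions of two norms -/

/-- Away from the null set `{0}` the space is the product of the unit sphere and the half-line, and
the integrand ignores the sphere. -/
lemma lintegral_fun_norm_addHaar {E : Type*} [NormedAddCommGroup E] [NormedSpace ℝ E]
    [MeasurableSpace E] [BorelSpace E] [FiniteDimensional ℝ E] [Nontrivial E] (μ : Measure E)
    [μ.IsAddHaarMeasure] {f : ℝ → ℝ≥0∞} (hf : Measurable f) :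
    ∫⁻ x, f ‖x‖ ∂μ = μ.toSphere Set.univ *
      ∫⁻ r in Set.Ioi (0 : ℝ), ENNReal.ofReal (r ^ (Module.finrank ℝ E - 1)) * f r := by
  calc
    ∫⁻ x, f ‖x‖ ∂μ = ∫⁻ x : ({(0)}ᶜ : Set E), f ‖x.1‖ ∂(μ.comap (↑)) := by
      rw [lintegral_subtype_comap (measurableSet_singleton _).compl fun x => f ‖x‖,
        restrict_compl_singleton]
    _ = ∫⁻ x, f x.2 ∂μ.toSphere.prod (.volumeIoiPow (Module.finrank ℝ E - 1)) := by
      simpa using μ.measurePreserving_homeomorphUnitSphereProd.lintegral_comp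
        (f := f ∘ Subtype.val ∘ Prod.snd) (by fun_prop)
    _ = μ.toSphere Set.univ *
        ∫⁻ x : Set.Ioi (0 : ℝ), f x ∂.volumeIoiPow (Module.finrank ℝ E - 1) := by
      have := lintegral_prod_mul (μ := μ.toSphere)
        (ν := Measure.volumeIoiPow (Module.finrank ℝ E - 1)) (f := fun _ => 1)
        (g := fun x : Set.Ioi (0 : ℝ) => f x) (by fun_prop) (by fun_prop)
      simpa using this
    _ = _ := by
      rw [Measure.volumeIoiPow, lintegral_withDensity_eq_lintegral_mul _ (by fun_prop)
        (by fun_prop)]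
      congr 1
      exact lintegral_subtype_comap measurableSet_Ioi
        fun r => ENNReal.ofReal (r ^ (Module.finrank ℝ E - 1)) * f r

/-- Substitute `t = cos θ`: the Jacobian takes one factor of `sin θ`, leaving `sin θ ^ (b - 1) = (1
- t²) ^ ((b + 1) / 2 - 1)`. -/
lemma lintegral_cos_sin_eq_lintegral_gb1Shape (a b : ℕ) {f : ℝ → ℝ≥0∞} (hf : Measurable f) :
    ∫⁻ θ in Set.Ioo (0 : ℝ) (Real.pi / 2),
      ENNReal.ofReal (Real.cos θ ^ a * Real.sin θ ^ b) * f (Real.cos θ) =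
    ∫⁻ t, f t ∂gb1Shape ((a + 1) / 2) ((b + 1) / 2) := by
  have himg : Real.cos '' Set.Ioo 0 (Real.pi / 2) = Set.Ioo 0 1 := by
    ext u
    constructor
    · rintro ⟨t, ⟨h0, h1⟩, rfl⟩
      refine ⟨Real.cos_pos_of_mem_Ioo ⟨by linarith, h1⟩, ?_⟩
      rw [← Real.cos_zero]
      exact Real.strictAntiOn_cos ⟨le_rfl, Real.pi_pos.le⟩ ⟨h0.le, by linarith⟩ h0
    · rintro ⟨h0, h1⟩
      exact ⟨Real.arccos u, ⟨Real.arccos_pos.2 h1, Real.arccos_lt_pi_div_two.2 h0⟩,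
        Real.cos_arccos (by linarith) h1.le⟩
  have key := lintegral_image_eq_lintegral_abs_deriv_mul (s := Set.Ioo (0 : ℝ) (Real.pi / 2))
    (f := Real.cos) (f' := fun t => - Real.sin t) measurableSet_Ioo
    (fun t _ => (Real.hasDerivAt_cos t).hasDerivWithinAt)
    (Real.strictAntiOn_cos.injOn.mono fun t (ht : t ∈ Set.Ioo 0 (Real.pi / 2)) =>
      Set.mem_Icc.2 ⟨ht.1.le, by linarith [ht.2, Real.pi_pos]⟩)
    (fun t => ENNReal.ofReal (t ^ (2 * (((a : ℝ) + 1) / 2) - 1) *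
      (1 - t ^ 2) ^ (((b : ℝ) + 1) / 2 - 1)) * f t)
  rw [himg] at key
  rw [gb1Shape, lintegral_withDensity_eq_lintegral_mul _ (by fun_prop) hf]
  refine Eq.trans (setLIntegral_congr_fun measurableSet_Ioo fun θ hθ => ?_) key.symm
  have hs : 0 < Real.sin θ := Real.sin_pos_of_pos_of_lt_pi hθ.1 (by linarith [hθ.2, Real.pi_pos])
  rw [← mul_assoc, ← ENNReal.ofReal_mul (abs_nonneg _), abs_neg, abs_of_pos hs,
    (by ring : 2 * (((a : ℝ) + 1) / 2) - 1 = a), Real.rpow_natCast, ← Real.sin_sq,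
    ← Real.rpow_natCast_mul hs.le]
  congr 2
  have : Real.sin θ ^ b = Real.sin θ * Real.sin θ ^ (((2 : ℕ) : ℝ) * (((b : ℝ) + 1) / 2 - 1)) := by
    nth_rw 2 [← Real.rpow_one (Real.sin θ)]
    rw [← Real.rpow_add hs, ← Real.rpow_natCast]
    congr 1
    push_cast
    ring
  rw [this]
  ring

/-- Polar coordinates in the positive quadrant. -/
lemma exists_lintegral_quadrant (a b : ℕ) : ∃ c : ℝ≥0∞, ∀ f : ℝ → ℝ≥0∞, Measurable f →
    ∫⁻ p : ℝ × ℝ in Set.Ioi 0 ×ˢ Set.Ioi 0, ENNReal.ofReal (p.1 ^ a * p.2 ^ b) *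
      ((Set.Iio 1).indicator 1 (p.1 ^ 2 + p.2 ^ 2) * f (p.1 / √(p.1 ^ 2 + p.2 ^ 2))) =
    c * ∫⁻ t, f t ∂gb1Shape ((a + 1) / 2) ((b + 1) / 2) := by
  -- The cutoff depends only on `r` and `f` only on `θ`, so the integral factors; the extra `1` in
  -- the exponent is the polar Jacobian.
  refine ⟨∫⁻ r in Set.Ioi (0 : ℝ), ENNReal.ofReal (r ^ (a + b + 1)) *
    (Set.Iio 1).indicator 1 (r ^ 2), fun f hf => ?_⟩
  have hind : Measurable ((Set.Iio (1 : ℝ)).indicator (1 : ℝ → ℝ≥0∞)) :=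
    measurable_one.indicator measurableSet_Iio
  rw [← lintegral_cos_sin_eq_lintegral_gb1Shape a b hf,
    ← lintegral_prod_mul (by fun_prop) (by fun_prop), Measure.prod_restrict,
    ← Measure.volume_eq_prod, ← lintegral_indicator (measurableSet_Ioi.prod measurableSet_Ioi),
    ← lintegral_comp_polarCoord_symm,
    ← lintegral_indicator (measurableSet_Ioi.prod measurableSet_Ioo),
    ← lintegral_indicator polarCoord.open_target.measurableSet]
  congr 1
  ext ⟨r, θ⟩
  by_cases hr : 0 < r
  swap
  · rw [Set.indicator_of_notMem (a := (r, θ)) (s := polarCoord.target) fun h => hr h.1,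
      Set.indicator_of_notMem (a := (r, θ)) (s := Set.Ioi 0 ×ˢ Set.Ioo 0 (Real.pi / 2))
        fun h => hr h.1]
  by_cases hθ : θ ∈ Set.Ioo 0 (Real.pi / 2)
  · have hc : 0 < Real.cos θ := Real.cos_pos_of_mem_Ioo ⟨by linarith [hθ.1, Real.pi_pos], hθ.2⟩
    have hs : 0 < Real.sin θ :=
      Real.sin_pos_of_pos_of_lt_pi hθ.1 (by linarith [hθ.2, Real.pi_pos])
    have hm : (r, θ) ∈ polarCoord.target :=
      ⟨hr, by linarith [hθ.1, Real.pi_pos], by linarith [hθ.2, Real.pi_pos]⟩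
    have hq : (r * Real.cos θ, r * Real.sin θ) ∈ Set.Ioi (0 : ℝ) ×ˢ Set.Ioi (0 : ℝ) :=
      ⟨mul_pos hr hc, mul_pos hr hs⟩
    rw [Set.indicator_of_mem hm, polarCoord_symm_apply, Set.indicator_of_mem hq,
      Set.indicator_of_mem (a := (r, θ)) (s := Set.Ioi 0 ×ˢ Set.Ioo 0 (Real.pi / 2)) ⟨hr, hθ⟩]
    dsimp only
    have h1 : (r * Real.cos θ) ^ 2 + (r * Real.sin θ) ^ 2 = r ^ 2 := by
      linear_combination r ^ 2 * Real.sin_sq_add_cos_sq θ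
    rw [h1, Real.sqrt_sq hr.le, mul_div_cancel_left₀ _ hr.ne', smul_eq_mul]
    have h2 : ENNReal.ofReal r * ENNReal.ofReal ((r * Real.cos θ) ^ a * (r * Real.sin θ) ^ b) =
        ENNReal.ofReal (r ^ (a + b + 1)) * ENNReal.ofReal (Real.cos θ ^ a * Real.sin θ ^ b) := by
      rw [← ENNReal.ofReal_mul hr.le, ← ENNReal.ofReal_mul (by positivity)]
      congr 1
      ring
    rw [← mul_assoc, h2, mul_assoc, mul_mul_mul_comm, ← mul_assoc, ← mul_assoc]
  · rw [Set.indicator_of_notMem (a := (r, θ)) (s := Set.Ioi 0 ×ˢ Set.Ioo 0 (Real.pi / 2))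
      fun h => hθ h.2]
    by_cases hmem : (r, θ) ∈ polarCoord.target
    -- On `(-π, π)`, positive sine and cosine together force `0 < θ < π / 2`.
    · have hq : (r * Real.cos θ, r * Real.sin θ) ∉ Set.Ioi (0 : ℝ) ×ˢ Set.Ioi (0 : ℝ) := by
        rintro ⟨hc, hs⟩
        have hc' : 0 < Real.cos θ := (mul_pos_iff_of_pos_left hr).1 hc
        have hs' : 0 < Real.sin θ := (mul_pos_iff_of_pos_left hr).1 hs
        have hm : -Real.pi < θ ∧ θ < Real.pi := hmem.2
        refine hθ ⟨?_, ?_⟩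
        · by_contra h
          exact absurd hs' (not_lt.2 (Real.sin_nonpos_of_nonpos_of_neg_pi_le (not_lt.1 h) hm.1.le))
        · by_contra h
          exact absurd hc' (not_lt.2 (Real.cos_nonpos_of_pi_div_two_le_of_le (not_lt.1 h)
            (by linarith [Real.pi_pos])))
      rw [Set.indicator_of_mem hmem, polarCoord_symm_apply, Set.indicator_of_notMem hq, smul_zero]
    · rw [Set.indicator_of_notMem hmem]

/-- The law of `‖z‖ / √(‖z‖ ^ 2 + ‖w‖ ^ 2)` for `(z, w)` in the Euclidean unit ball is a
generalized beta distribution, up to normalization. -/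
lemma exists_lintegral_norm_prod {E F : Type*} [NormedAddCommGroup E] [NormedSpace ℝ E]
    [MeasurableSpace E] [BorelSpace E] [FiniteDimensional ℝ E] [Nontrivial E]
    [NormedAddCommGroup F] [NormedSpace ℝ F]
    [MeasurableSpace F] [BorelSpace F] [FiniteDimensional ℝ F] [Nontrivial F]
    (μ : Measure E) [μ.IsAddHaarMeasure] (ν : Measure F) [ν.IsAddHaarMeasure] :
    ∃ c : ℝ≥0∞, ∀ f : ℝ → ℝ≥0∞, Measurable f →
      ∫⁻ p, (Set.Iio 1).indicator 1 (‖p.1‖ ^ 2 + ‖p.2‖ ^ 2) *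
        f (‖p.1‖ / √(‖p.1‖ ^ 2 + ‖p.2‖ ^ 2)) ∂μ.prod ν =
      c * ∫⁻ t, f t ∂gb1Shape (Module.finrank ℝ E / 2) (Module.finrank ℝ F / 2) := by
  -- These exponents are the radial densities of the two factors; both dimensions are positive, so
  -- the truncated subtractions are genuine.
  obtain ⟨c, hc⟩ := exists_lintegral_quadrant (Module.finrank ℝ E - 1) (Module.finrank ℝ F - 1)
  have hE : 0 < Module.finrank ℝ E := Module.finrank_pos
  have hF : 0 < Module.finrank ℝ F := Module.finrank_pos
  refine ⟨μ.toSphere Set.univ * ν.toSphere Set.univ * c, fun f hf => ?_⟩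
  have hind : Measurable ((Set.Iio (1 : ℝ)).indicator (1 : ℝ → ℝ≥0∞)) :=
    measurable_one.indicator measurableSet_Iio
  set G : ℝ → ℝ → ℝ≥0∞ := fun r s => (Set.Iio 1).indicator 1 (r ^ 2 + s ^ 2) *
    f (r / √(r ^ 2 + s ^ 2)) with hG
  have hGm : Measurable fun p : ℝ × ℝ => G p.1 p.2 := by
    simp only [hG]
    fun_prop
  specialize hc f hf
  rw [Nat.cast_pred hE, Nat.cast_pred hF, sub_add_cancel, sub_add_cancel,
    Measure.volume_eq_prod, ← Measure.prod_restrict, lintegral_prod _ (by fun_prop)] at hc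
  rw [mul_assoc, ← hc, lintegral_prod _ (by fun_prop)]
  change ∫⁻ x, ∫⁻ y, G ‖x‖ ‖y‖ ∂ν ∂μ = _
  have h1 : ∀ x : E, ∫⁻ y, G ‖x‖ ‖y‖ ∂ν = ν.toSphere Set.univ *
      ∫⁻ s in Set.Ioi (0 : ℝ), ENNReal.ofReal (s ^ (Module.finrank ℝ F - 1)) * G ‖x‖ s :=
    fun x => lintegral_fun_norm_addHaar ν (hGm.comp (measurable_const.prodMk measurable_id))
  have h2 : Measurable fun r => ∫⁻ s in Set.Ioi (0 : ℝ),
      ENNReal.ofReal (s ^ (Module.finrank ℝ F - 1)) * G r s := by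
    refine Measurable.lintegral_prod_right'
      (f := fun p : ℝ × ℝ => ENNReal.ofReal (p.2 ^ (Module.finrank ℝ F - 1)) * G p.1 p.2) ?_
    fun_prop
  simp_rw [h1]
  rw [lintegral_fun_norm_addHaar μ (h2.const_mul _), mul_assoc]
  congr 1
  rw [← lintegral_const_mul' _ _ (measure_ne_top _ _)]
  refine setLIntegral_congr_fun measurableSet_Ioi fun r hr => ?_
  have hr : 0 < r := hr
  rw [mul_left_comm, ← lintegral_const_mul' _ _ ENNReal.ofReal_ne_top]
  congr 1
  refine lintegral_congr fun s => ?_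
  rw [← mul_assoc, ← ENNReal.ofReal_mul (by positivity)]

end SingularPencil

namespace SingularPencil

/-! ### A coordinate of a vector with invariant direction -/

section Direction

variable {𝕜 : Type*} [RCLike 𝕜]

/-- The image measure is a multiple of `μ` by uniqueness of Haar measure, and the unit ball, which
is preserved and has positive finite mass, fixes the multiple to be `1`. -/
lemma measurePreserving_addHaar_linearIsometryEquiv {E : Type*} [NormedAddCommGroup E]
    [NormedSpace 𝕜 E] [FiniteDimensional 𝕜 E] [MeasurableSpace E] [BorelSpace E]
    (μ : Measure E) [μ.IsAddHaarMeasure] (L : E ≃ₗᵢ[𝕜] E) : MeasurePreserving L μ μ := by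
  have : ProperSpace E := FiniteDimensional.proper 𝕜 E
  refine ⟨L.continuous.measurable, ?_⟩
  have h : (μ.map L).IsAddHaarMeasure :=
    L.toLinearEquiv.toAddEquiv.isAddHaarMeasure_map μ L.continuous L.symm.continuous
  have hb : μ (Metric.ball 0 1) ≠ 0 := (Metric.measure_ball_pos μ 0 one_pos).ne'
  have hb' : μ (Metric.ball 0 1) ≠ ∞ := measure_ball_lt_top.ne
  have hball : μ.map L (Metric.ball 0 1) = μ (Metric.ball 0 1) := by
    rw [Measure.map_apply L.continuous.measurable Metric.isOpen_ball.measurableSet]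
    congr 1
    ext x
    simp
  obtain ⟨c, hc⟩ : ∃ c : ℝ≥0∞, μ.map L = c • μ :=
    ⟨_, Measure.isAddLeftInvariant_eq_smul (μ.map L) μ⟩
  rw [hc, Measure.smul_apply, smul_eq_mul] at hball
  rw [hc, (ENNReal.mul_eq_right hb hb').1 hball, one_smul]

lemma exists_linearIsometryEquiv_apply_eq {E : Type*} [NormedAddCommGroup E]
    [InnerProductSpace 𝕜 E] [FiniteDimensional 𝕜 E] {p e : E} (hp : ‖p‖ = 1) (he : ‖e‖ = 1) :
    ∃ L : E ≃ₗᵢ[𝕜] E, L p = e := by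
  have hp0 : p ≠ 0 := by
    rintro rfl
    simp at hp
  let f : (𝕜 ∙ p) →ₗᵢ[𝕜] E :=
    ((LinearIsometry.toSpanSingleton 𝕜 E he).comp
      (LinearIsometryEquiv.toSpanUnitSingleton p hp).symm.toLinearIsometry)
  refine ⟨f.extend.toLinearIsometryEquiv rfl, ?_⟩
  have h := f.extend_apply ⟨p, Submodule.mem_span_singleton_self p⟩
  have h2 : (⟨p, Submodule.mem_span_singleton_self p⟩ : 𝕜 ∙ p) =
      LinearIsometryEquiv.toSpanUnitSingleton p hp 1 := by
    ext
    simp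
  rw [LinearIsometry.coe_toLinearIsometryEquiv, h, h2]
  change LinearIsometry.toSpanSingleton 𝕜 E he
    ((LinearIsometryEquiv.toSpanUnitSingleton p hp).symm _) = e
  rw [LinearIsometryEquiv.symm_apply_apply]
  simp

/-- Randomizes the test vector: by `hinv`, `e` may be replaced by `g / ‖g‖` with `g` in the ball,
and after exchanging the integrals, rotation invariance of `μ` removes all dependence on `c`. -/
lemma measure_ball_mul_lintegral_norm_inner {ι Ω : Type*} [Fintype ι]
    [MeasurableSpace Ω] (ρ : Measure Ω) [IsProbabilityMeasure ρ]
    (μ : Measure (EuclideanSpace 𝕜 ι)) [μ.IsAddHaarMeasure] {c : Ω → EuclideanSpace 𝕜 ι}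
    (hc : Measurable c) (hc1 : ∀ᵐ ω ∂ρ, ‖c ω‖ = 1) {e : EuclideanSpace 𝕜 ι} (he : ‖e‖ = 1)
    (hinv : ∀ u : EuclideanSpace 𝕜 ι, ‖u‖ = 1 →
      ρ.map (fun ω => ‖inner 𝕜 u (c ω)‖) = ρ.map fun ω => ‖inner 𝕜 e (c ω)‖)
    {f : ℝ → ℝ≥0∞} (hf : Measurable f) :
    μ (Metric.ball 0 1) * ∫⁻ ω, f ‖inner 𝕜 e (c ω)‖ ∂ρ =
      ∫⁻ g in Metric.ball 0 1, f (‖inner 𝕜 e g‖ / ‖g‖) ∂μ := by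
  have : Nontrivial (EuclideanSpace 𝕜 ι) := ⟨e, 0, fun h => by simp [h] at he⟩
  have hm : ∀ u : EuclideanSpace 𝕜 ι, Measurable fun ω => ‖inner 𝕜 u (c ω)‖ := fun u =>
    (continuous_const.inner continuous_id).norm.measurable.comp hc
  have hjoint : Measurable fun q : EuclideanSpace 𝕜 ι × Ω =>
      f (‖inner 𝕜 q.1 (c q.2)‖ / ‖q.1‖) := by
    have : Measurable fun q : EuclideanSpace 𝕜 ι × Ω => ‖inner 𝕜 q.1 (c q.2)‖ :=
      (measurable_fst.inner (hc.comp measurable_snd)).norm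
    fun_prop
  calc μ (Metric.ball 0 1) * ∫⁻ ω, f ‖inner 𝕜 e (c ω)‖ ∂ρ
      = ∫⁻ _ in Metric.ball 0 1, ∫⁻ ω, f ‖inner 𝕜 e (c ω)‖ ∂ρ ∂μ := by
        rw [setLIntegral_const, mul_comm]
    _ = ∫⁻ g in Metric.ball 0 1, ∫⁻ ω, f (‖inner 𝕜 g (c ω)‖ / ‖g‖) ∂ρ ∂μ := by
        have hne : ∀ᵐ g ∂μ.restrict (Metric.ball 0 1), g ≠ 0 :=
          ae_restrict_of_ae (Measure.ae_ne μ 0)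
        refine lintegral_congr_ae (hne.mono fun g hg => ?_)
        have hu : ‖((‖g‖ : 𝕜)⁻¹) • g‖ = 1 := norm_smul_inv_norm hg
        dsimp only
        rw [← lintegral_map hf (hm e), ← hinv _ hu, lintegral_map hf (hm _)]
        refine lintegral_congr fun ω => ?_
        rw [inner_smul_left, norm_mul, div_eq_inv_mul]
        simp
    _ = ∫⁻ ω, ∫⁻ g in Metric.ball 0 1, f (‖inner 𝕜 g (c ω)‖ / ‖g‖) ∂μ ∂ρ :=
        lintegral_lintegral_swap hjoint.aemeasurable
    _ = ∫⁻ _, ∫⁻ g in Metric.ball 0 1, f (‖inner 𝕜 e g‖ / ‖g‖) ∂μ ∂ρ := by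
        -- For fixed `ω`, an isometry carrying `c ω` to `e` preserves both the ball and `μ`.
        refine lintegral_congr_ae (hc1.mono fun ω hω => ?_)
        obtain ⟨L, hL⟩ := exists_linearIsometryEquiv_apply_eq (𝕜 := 𝕜) hω he
        have hpre : L ⁻¹' Metric.ball 0 1 = Metric.ball 0 1 := by
          ext x
          simp
        have hmp := (measurePreserving_addHaar_linearIsometryEquiv μ L).restrict_preimage
          (s := Metric.ball 0 1) Metric.isOpen_ball.measurableSet
        rw [hpre] at hmp
        have hme : Measurable fun g : EuclideanSpace 𝕜 ι => f (‖inner 𝕜 e g‖ / ‖g‖) := by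
          have : Measurable fun g : EuclideanSpace 𝕜 ι => ‖inner 𝕜 e g‖ :=
            (continuous_const.inner continuous_id).norm.measurable
          fun_prop
        rw [← hmp.lintegral_comp hme]
        refine lintegral_congr fun g => ?_
        rw [← hL, L.inner_map_map, L.norm_map, norm_inner_symm]
    _ = _ := by simp

/-- The linear equivalence splitting off the last coordinate. -/
noncomputable def prodLastEquiv (𝕜 : Type*) [RCLike 𝕜] (k : ℕ) :
    (𝕜 × EuclideanSpace 𝕜 (Fin k)) ≃L[𝕜] EuclideanSpace 𝕜 (Fin k ⊕ Unit) :=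
  LinearEquiv.toContinuousLinearEquiv
    { toFun := fun q => WithLp.toLp 2 (Sum.elim q.2 fun _ => q.1)
      map_add' := fun q r => by
        ext (i | i) <;> simp
      map_smul' := fun a q => by
        ext (i | i) <;> simp
      invFun := fun g => (g (Sum.inr ()), WithLp.toLp 2 fun i => g (Sum.inl i))
      left_inv := fun q => by
        ext <;> simp
      right_inv := fun g => by
        ext (i | i) <;> simp }

lemma prodLastEquiv_apply {k : ℕ} (q : 𝕜 × EuclideanSpace 𝕜 (Fin k)) :
    prodLastEquiv 𝕜 k q = WithLp.toLp 2 (Sum.elim q.2 fun _ => q.1) := rfl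

lemma norm_prodLastEquiv {k : ℕ} (q : 𝕜 × EuclideanSpace 𝕜 (Fin k)) :
    ‖prodLastEquiv 𝕜 k q‖ = √(‖q.1‖ ^ 2 + ‖q.2‖ ^ 2) := by
  rw [prodLastEquiv_apply, EuclideanSpace.norm_eq, Fintype.sum_sum_type,
    EuclideanSpace.norm_sq_eq q.2]
  simp [add_comm]

/-- If the law of `‖⟪u, c⟫‖` is the same for all unit vectors `u`, where `c` is a random unit vector,
then that law is a generalized beta distribution. -/
theorem map_norm_inner_eq_gb1Measure {k : ℕ} (hk : 1 ≤ k) {Ω : Type*} [MeasurableSpace Ω]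
    (ρ : Measure Ω) [IsProbabilityMeasure ρ] {c : Ω → EuclideanSpace 𝕜 (Fin k ⊕ Unit)}
    (hc : Measurable c) (hc1 : ∀ᵐ ω ∂ρ, ‖c ω‖ = 1)
    (hinv : ∀ u : EuclideanSpace 𝕜 (Fin k ⊕ Unit), ‖u‖ = 1 →
      ρ.map (fun ω => ‖inner 𝕜 u (c ω)‖) = ρ.map fun ω => ‖c ω (Sum.inr ())‖) :
    ρ.map (fun ω => ‖c ω (Sum.inr ())‖) =
      gb1Measure 2 1 (Module.finrank ℝ 𝕜 / 2) (Module.finrank ℝ 𝕜 * k / 2) := by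
  have : NeZero k := ⟨by omega⟩
  have hd : 0 < Module.finrank ℝ 𝕜 := Module.finrank_pos
  have hdk : Module.finrank ℝ (EuclideanSpace 𝕜 (Fin k)) = Module.finrank ℝ 𝕜 * k := by
    rw [← Module.finrank_mul_finrank ℝ 𝕜, finrank_euclideanSpace_fin]
  obtain ⟨C, hC⟩ := exists_lintegral_norm_prod (Measure.addHaar : Measure 𝕜)
    (Measure.addHaar : Measure (EuclideanSpace 𝕜 (Fin k)))
  set e : EuclideanSpace 𝕜 (Fin k ⊕ Unit) := EuclideanSpace.single (Sum.inr ()) 1 with he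
  have hinner : ∀ g : EuclideanSpace 𝕜 (Fin k ⊕ Unit), inner 𝕜 e g = g (Sum.inr ()) := fun g => by
    simp [he, EuclideanSpace.inner_single_left]
  set T := prodLastEquiv 𝕜 k with hT
  have hTm : Measurable T := T.continuous.measurable
  set μ : Measure (EuclideanSpace 𝕜 (Fin k ⊕ Unit)) :=
    (Measure.addHaar.prod Measure.addHaar).map T with hμ
  have hμH : μ.IsAddHaarMeasure := T.toAddEquiv.isAddHaarMeasure_map _ T.continuous T.symm.continuous
  have hmeas : Measurable fun ω => ‖c ω (Sum.inr ())‖ := by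
    simp_rw [← hinner]
    exact (continuous_const.inner continuous_id).norm.measurable.comp hc
  have hb : μ (Metric.ball 0 1) ≠ 0 := (Metric.measure_ball_pos μ 0 one_pos).ne'
  have hb' : μ (Metric.ball 0 1) ≠ ∞ := measure_ball_lt_top.ne
  have : IsProbabilityMeasure (ρ.map fun ω => ‖c ω (Sum.inr ())‖) :=
    Measure.isProbabilityMeasure_map hmeas.aemeasurable
  -- Both measures have mass one, so proportionality suffices and `C` need not be computed.
  refine eq_gb1Measure_of_eq_smul (c := (μ (Metric.ball 0 1))⁻¹ * C) (by positivity)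
    (by positivity) ?_
  refine Measure.ext_of_lintegral _ fun f hf => ?_
  have hμf : ∫⁻ g in Metric.ball 0 1, f (‖inner 𝕜 e g‖ / ‖g‖) ∂μ =
      C * ∫⁻ t, f t ∂gb1Shape (Module.finrank ℝ 𝕜 / 2) (Module.finrank ℝ 𝕜 * k / 2) := by
    specialize hC f hf
    rw [hdk, Nat.cast_mul] at hC
    rw [← hC, ← lintegral_indicator Metric.isOpen_ball.measurableSet, hμ, lintegral_map _ hTm]
    · refine lintegral_congr fun q => ?_
      have h1 : inner 𝕜 e (T q) = q.1 := by
        rw [hinner, hT, prodLastEquiv_apply]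
        rfl
      have h2 : ‖T q‖ = √(‖q.1‖ ^ 2 + ‖q.2‖ ^ 2) := norm_prodLastEquiv q
      by_cases hq : ‖q.1‖ ^ 2 + ‖q.2‖ ^ 2 < 1
      · rw [Set.indicator_of_mem, Set.indicator_of_mem (s := Set.Iio 1) hq, h1, h2, Pi.one_apply,
          one_mul]
        rwa [mem_ball_zero_iff, h2, Real.sqrt_lt' one_pos, one_pow]
      · rw [Set.indicator_of_notMem, Set.indicator_of_notMem (s := Set.Iio 1) hq, zero_mul]
        rwa [mem_ball_zero_iff, h2, Real.sqrt_lt' one_pos, one_pow]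
    · refine Measurable.indicator ?_ Metric.isOpen_ball.measurableSet
      have : Measurable fun g : EuclideanSpace 𝕜 (Fin k ⊕ Unit) => ‖inner 𝕜 e g‖ :=
        (continuous_const.inner continuous_id).norm.measurable
      fun_prop
  have key := measure_ball_mul_lintegral_norm_inner (𝕜 := 𝕜) ρ μ hc hc1 (e := e) (by simp [he])
    (by simpa only [hinner] using hinv) hf
  simp only [hinner] at key hμf
  rw [lintegral_map hf hmeas, lintegral_smul_measure, smul_eq_mul, mul_assoc, ← hμf, ← key,
    ← mul_assoc, ENNReal.inv_mul_cancel hb hb', one_mul]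

end Direction

end SingularPencil

namespace SingularPencil

section Generic

variable {𝕜 : Type*} [RCLike 𝕜]

/-! ### Extending orthonormal columns to a unitary matrix -/

lemma norm_toLp_mulVec {m ι : Type*} [Fintype m] [Fintype ι] [DecidableEq ι]
    {M : Matrix m ι 𝕜} (hM : Mᴴ * M = 1) (v : ι → 𝕜) :
    ‖WithLp.toLp 2 (M *ᵥ v)‖ = ‖WithLp.toLp 2 v‖ := by
  rw [← sq_eq_sq₀ (norm_nonneg _) (norm_nonneg _), ← RCLike.ofReal_inj (K := 𝕜),
    RCLike.ofReal_pow, RCLike.ofReal_pow, ← inner_self_eq_norm_sq_to_K,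
    ← inner_self_eq_norm_sq_to_K, EuclideanSpace.inner_toLp_toLp, EuclideanSpace.inner_toLp_toLp,
    Matrix.star_mulVec, dotProduct_comm, ← Matrix.dotProduct_mulVec, Matrix.mulVec_mulVec, hM,
    Matrix.one_mulVec, dotProduct_comm]

/-- The isometry given by a matrix with orthonormal columns. -/
noncomputable def isometryOfColumns {m ι : Type*} [Fintype m] [Fintype ι] [DecidableEq ι]
    (M : Matrix m ι 𝕜) (hM : Mᴴ * M = 1) : EuclideanSpace 𝕜 ι →ₗᵢ[𝕜] EuclideanSpace 𝕜 m where
  toFun v := WithLp.toLp 2 (M *ᵥ v.ofLp)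
  map_add' v w := by simp [Matrix.mulVec_add]
  map_smul' a v := by simp [Matrix.mulVec_smul]
  norm_map' v := norm_toLp_mulVec hM v.ofLp

/-- The isometry between the column spaces sending each column of `M` to that of `N` extends to the
whole space; `Q` is its matrix in the standard basis. -/
lemma exists_unitary_mul_eq {m ι : Type*} [Fintype m] [DecidableEq m] [Fintype ι] [DecidableEq ι]
    {M N : Matrix m ι 𝕜} (hM : Mᴴ * M = 1) (hN : Nᴴ * N = 1) :
    ∃ Q ∈ Matrix.unitaryGroup m 𝕜, Q * M = N := by
  let f := isometryOfColumns M hM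
  let L : f.range →ₗᵢ[𝕜] EuclideanSpace 𝕜 m :=
    (isometryOfColumns N hN).comp f.equivRange.symm.toLinearIsometry
  let U : EuclideanSpace 𝕜 m ≃ₗᵢ[𝕜] EuclideanSpace 𝕜 m := L.extend.toLinearIsometryEquiv rfl
  have hU : ∀ v, U (f v) = isometryOfColumns N hN v := fun v => by
    have h := L.extend_apply (f.equivRange v)
    have h2 : L (f.equivRange v) = isometryOfColumns N hN v := by
      change isometryOfColumns N hN (f.equivRange.symm (f.equivRange v)) = _
      rw [LinearIsometryEquiv.symm_apply_apply]
    exact h.trans h2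
  let b := EuclideanSpace.basisFun m 𝕜
  refine ⟨b.toBasis.toMatrix (b.map U), b.toMatrix_orthonormalBasis_mem_unitary (b.map U), ?_⟩
  have hQ : ∀ v : EuclideanSpace 𝕜 m, b.toBasis.toMatrix (b.map U) *ᵥ v.ofLp = (U v).ofLp := by
    intro v
    ext i
    conv_rhs => rw [← b.sum_repr v, map_sum]
    simp [Matrix.mulVec, dotProduct, Module.Basis.toMatrix_apply, b, mul_comm]
  ext i j
  have h := congrArg (fun w : EuclideanSpace 𝕜 m => w i) (hU (EuclideanSpace.single j 1))
  have h1 := congrFun (hQ (f (EuclideanSpace.single j 1))) i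
  rw [h] at h1
  have h2 : (b.toBasis.toMatrix (b.map U) *ᵥ M.col j) i = N i j := by
    simpa [f, isometryOfColumns, Matrix.mulVec_single] using h1
  exact h2

/-! ### Null sets of matrices -/

/-- By Fubini some `t ≠ 0` has `z₀ + t z ∉ B` for almost every `z`; undoing the translation and the
scaling shows that `B` is null. -/
lemma measure_eq_zero_of_countable_lines {E : Type*} [NormedAddCommGroup E] [NormedSpace ℝ E]
    [FiniteDimensional ℝ E] [MeasurableSpace E] [BorelSpace E] (μ : Measure E)
    [μ.IsAddHaarMeasure] {B : Set E} (hB : MeasurableSet B) (z₀ : E)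
    (h : ∀ z, {t : ℝ | z₀ + t • z ∈ B}.Countable) : μ B = 0 := by
  have hm : MeasurableSet {q : E × ℝ | z₀ + q.2 • q.1 ∈ B} :=
    (by fun_prop : Measurable fun q : E × ℝ => z₀ + q.2 • q.1) hB
  have h1 : ∀ᵐ z ∂μ, ∀ᵐ t : ℝ, ¬ (z₀ + t • z ∈ B) := by
    refine Filter.Eventually.of_forall fun z => ?_
    rw [ae_iff]
    simpa using (h z).measure_zero volume
  rw [Measure.ae_ae_comm hm.compl] at h1
  obtain ⟨t, ht, ht0⟩ := (h1.and (Measure.ae_ne volume 0)).exists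
  rw [ae_iff] at ht
  simp only [not_not] at ht
  have h2 : {z | z₀ + t • z ∈ B} = (fun z => t • z) ⁻¹' ((fun z => z₀ + z) ⁻¹' B) := rfl
  rw [h2, Measure.addHaar_preimage_smul μ ht0, measure_preimage_add] at ht
  refine (mul_eq_zero.1 ht).resolve_left ?_
  simp [ht0]

/-- On the line `V + t Z` through `V` itself the determinant is `det (1 + t Zᴴ V)`, a polynomial in
`t` with value `1` at `0`, so it has finitely many zeros. -/
lemma ae_det_conjTranspose_mul_ne_zero {n k : ℕ} {V : Matrix (Fin n) (Fin k) 𝕜} (hV : Vᴴ * V = 1)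
    (μ : Measure (Fin n → Fin k → 𝕜)) [μ.IsAddHaarMeasure] :
    ∀ᵐ Z ∂μ, ((Matrix.of Z)ᴴ * V).det ≠ 0 := by
  rw [ae_iff]
  simp only [not_not]
  refine measure_eq_zero_of_countable_lines μ ?_ (Matrix.of.symm V) fun Z => Set.Finite.countable ?_
  · have : Continuous fun Z : Fin n → Fin k → 𝕜 => ((Matrix.of Z)ᴴ * V).det := by
      refine Continuous.matrix_det (Continuous.matrix_mul (Continuous.matrix_conjTranspose ?_)
        continuous_const)
      exact continuous_id
    exact (isClosed_singleton.preimage this).measurableSet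
  · set p := (-((Matrix.of Z)ᴴ * V)).charpolyRev with hp
    have hp0 : p ≠ 0 := fun h0 => by
      have := Matrix.eval_charpolyRev (M := -((Matrix.of Z)ᴴ * V))
      rw [← hp, h0, eval_zero] at this
      exact zero_ne_one this
    refine ((p.rootSet_finite 𝕜).preimage (RCLike.ofReal_injective.injOn (s := _))).subset ?_
    intro t ht
    have hdet : ((Matrix.of (Matrix.of.symm V + t • Z))ᴴ * V).det = p.eval (t : 𝕜) := by
      have h2 : Matrix.of (Matrix.of.symm V + t • Z) = V + (t : 𝕜) • Matrix.of Z := by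
        ext i j
        exact congrArg (V i j + ·) (RCLike.real_smul_eq_coe_mul t (Z i j))
      rw [h2, Matrix.conjTranspose_add, Matrix.conjTranspose_smul, Matrix.add_mul, hV,
        Matrix.smul_mul, hp, Matrix.charpolyRev, ← coe_evalRingHom, RingHom.map_det]
      congr 1
      ext i j
      by_cases hij : i = j <;> simp [hij] <;> rw [RCLike.real_smul_eq_coe_mul, mul_comm]
    rw [Set.mem_preimage, Polynomial.mem_rootSet]
    refine ⟨hp0, ?_⟩
    rw [Polynomial.aeval_def, Algebra.algebraMap_self, Polynomial.eval₂_id, ← hdet]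
    exact ht

/-! ### The uniform distribution on the Stiefel manifold -/

instance (n k : ℕ) : SecondCountableTopology (Matrix (Fin n) (Fin k) 𝕜) :=
  inferInstanceAs (SecondCountableTopology (Fin n → Fin k → 𝕜))

instance (n : ℕ) : IsProbabilityMeasure (haarUnitary 𝕜 n) :=
  ⟨Measure.haarMeasure_self (K₀ := ⊤)⟩

instance (n : ℕ) : (haarUnitary 𝕜 n).IsMulLeftInvariant :=
  Measure.isMulLeftInvariant_haarMeasure _

lemma continuous_firstCols (n k : ℕ) : Continuous
    fun W : Matrix.unitaryGroup (Fin n) 𝕜 => firstCols k (W : Matrix (Fin n) (Fin n) 𝕜) :=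
  Continuous.matrix_mul continuous_subtype_val continuous_const

instance (n k : ℕ) : IsProbabilityMeasure (stiefelUniform 𝕜 n k) :=
  Measure.isProbabilityMeasure_map (continuous_firstCols n k).measurable.aemeasurable

/-- Taking first columns commutes with left multiplication, so this is the left invariance of Haar
measure. -/
lemma measurePreserving_mul_stiefelUniform {n k : ℕ} {Q : Matrix (Fin n) (Fin n) 𝕜}
    (hQ : Q ∈ Matrix.unitaryGroup (Fin n) 𝕜) :
    MeasurePreserving (fun V => Q * V) (stiefelUniform 𝕜 n k) (stiefelUniform 𝕜 n k) := by
  have hm : Measurable fun V : Matrix (Fin n) (Fin k) 𝕜 => Q * V :=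
    (Continuous.matrix_mul continuous_const continuous_id).measurable
  refine ⟨hm, ?_⟩
  rw [stiefelUniform, Measure.map_map hm (continuous_firstCols n k).measurable]
  conv_rhs => rw [← map_mul_left_eq_self (haarUnitary 𝕜 n) ⟨Q, hQ⟩,
    Measure.map_map (continuous_firstCols n k).measurable (measurable_const_mul _)]
  congr 1
  ext W
  simp [firstCols, Matrix.mul_assoc]

lemma ae_conjTranspose_mul_self_stiefelUniform {n k : ℕ} (hk : k ≤ n) :
    ∀ᵐ V ∂stiefelUniform 𝕜 n k, Vᴴ * V = 1 := by
  have hc : Continuous fun V : Matrix (Fin n) (Fin k) 𝕜 => Vᴴ * V :=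
    Continuous.matrix_mul (Continuous.matrix_conjTranspose continuous_id) continuous_id
  rw [stiefelUniform, ae_map_iff (continuous_firstCols n k).measurable.aemeasurable
    (isClosed_eq hc continuous_const).measurableSet]
  refine Filter.Eventually.of_forall fun W => ?_
  have hW : (W : Matrix (Fin n) (Fin n) 𝕜)ᴴ * (W : Matrix (Fin n) (Fin n) 𝕜) = 1 :=
    Matrix.mem_unitaryGroup_iff'.1 W.2
  rw [firstCols, Matrix.conjTranspose_mul, Matrix.mul_assoc, ← Matrix.mul_assoc _ _ (Matrix.of _),
    hW, Matrix.one_mul]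
  ext i j
  rw [Matrix.mul_apply, Finset.sum_eq_single (Fin.castLE hk i)]
  · simp [Matrix.one_apply, Fin.ext_iff, apply_ite]
  · intro l _ hl
    have : (l : ℕ) ≠ i := fun h => hl (Fin.ext h)
    simp [this]
  · simp

lemma le_of_conjTranspose_mul_self_eq_one {n k : ℕ} {Z : Matrix (Fin n) (Fin k) 𝕜}
    (hZ : Zᴴ * Z = 1) : k ≤ n := by
  simpa using (isometryOfColumns Z hZ).toLinearMap.finrank_le_finrank_of_injective
    (isometryOfColumns Z hZ).injective

-- Factor the positive definite Gram matrix as `Zᴴ Z = Sᴴ S` and put `O = Z S⁻¹`.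
open scoped ComplexOrder MatrixOrder in
lemma exists_eq_orthonormal_mul {n k : ℕ} {Z : Matrix (Fin n) (Fin k) 𝕜}
    (hZ : Function.Injective Z.mulVec) :
    ∃ (O : Matrix (Fin n) (Fin k) 𝕜) (S : Matrix (Fin k) (Fin k) 𝕜), Oᴴ * O = 1 ∧ Z = O * S := by
  have hpd : (Zᴴ * Z).PosDef := Matrix.PosDef.conjTranspose_mul_self Z hZ
  obtain ⟨S, hS⟩ := CStarAlgebra.nonneg_iff_eq_star_mul_self.mp hpd.posSemidef.nonneg
  rw [Matrix.star_eq_conjTranspose] at hS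
  have hSu : IsUnit S.det := by
    have h := (Matrix.isUnit_iff_isUnit_det _).1 hpd.isUnit
    rw [hS, Matrix.det_mul] at h
    exact isUnit_of_mul_isUnit_right h
  refine ⟨Z * S⁻¹, S, ?_, ?_⟩
  · rw [Matrix.conjTranspose_mul, Matrix.mul_assoc, ← Matrix.mul_assoc Zᴴ, hS,
      Matrix.mul_assoc, Matrix.mul_nonsing_inv _ hSu, Matrix.mul_one,
      ← Matrix.conjTranspose_mul, Matrix.mul_nonsing_inv _ hSu, Matrix.conjTranspose_one]
  · rw [Matrix.mul_assoc, Matrix.nonsing_inv_mul _ hSu, Matrix.mul_one]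

/-- A uniformly distributed `k`-frame is almost surely in general position with respect to a given
`k`-frame. -/
theorem ae_det_conjTranspose_mul_stiefelUniform_ne_zero {n k : ℕ} {Z : Matrix (Fin n) (Fin k) 𝕜}
    (hZ : Zᴴ * Z = 1) : ∀ᵐ V ∂stiefelUniform 𝕜 n k, (Zᴴ * V).det ≠ 0 := by
  have hk := le_of_conjTranspose_mul_self_eq_one hZ
  have hmeas : MeasurableSet {q : Matrix (Fin n) (Fin k) 𝕜 × (Fin n → Fin k → 𝕜) |
      ((Matrix.of q.2)ᴴ * q.1).det ≠ 0} := by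
    have : Continuous fun q : Matrix (Fin n) (Fin k) 𝕜 × (Fin n → Fin k → 𝕜) =>
        ((Matrix.of q.2)ᴴ * q.1).det := by
      refine Continuous.matrix_det (Continuous.matrix_mul (Continuous.matrix_conjTranspose ?_)
        continuous_fst)
      exact continuous_snd
    exact (isOpen_ne.preimage this).measurableSet
  -- For each fixed frame `V` almost every matrix is good; exchanging the quantifiers by Fubini
  -- gives one matrix that is good for almost every `V`.
  obtain ⟨Z₀, hZ₀⟩ : ∃ Z₀ : Matrix (Fin n) (Fin k) 𝕜,
      ∀ᵐ V ∂stiefelUniform 𝕜 n k, (Z₀ᴴ * V).det ≠ 0 := by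
    have h1 : ∀ᵐ V ∂stiefelUniform 𝕜 n k, ∀ᵐ Z' ∂(Measure.addHaar : Measure (Fin n → Fin k → 𝕜)),
        ((Matrix.of Z')ᴴ * V).det ≠ 0 :=
      (ae_conjTranspose_mul_self_stiefelUniform hk).mono fun V hV =>
        ae_det_conjTranspose_mul_ne_zero hV _
    rw [Measure.ae_ae_comm hmeas] at h1
    exact h1.exists
  obtain ⟨O, hO, hOV⟩ : ∃ O : Matrix (Fin n) (Fin k) 𝕜, Oᴴ * O = 1 ∧
      ∀ᵐ V ∂stiefelUniform 𝕜 n k, (Oᴴ * V).det ≠ 0 := by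
    obtain ⟨V₀, hV₀⟩ := hZ₀.exists
    have hinj : Function.Injective Z₀.mulVec := by
      have h := Matrix.mulVec_injective_of_isUnit
        ((Matrix.isUnit_iff_isUnit_det _).2 (Ne.isUnit hV₀)).star
      have h2 : star (Z₀ᴴ * V₀) = V₀ᴴ * Z₀ := by
        rw [Matrix.star_eq_conjTranspose, Matrix.conjTranspose_mul, Matrix.conjTranspose_conjTranspose]
      rw [h2] at h
      refine Function.Injective.of_comp (f := V₀ᴴ.mulVec) ?_
      simpa only [Function.comp_def, Matrix.mulVec_mulVec] using h
    obtain ⟨O, S, hO, hOS⟩ := exists_eq_orthonormal_mul hinj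
    refine ⟨O, hO, hZ₀.mono fun V hV h0 => hV ?_⟩
    rw [hOS, Matrix.conjTranspose_mul, Matrix.mul_assoc, Matrix.det_mul, h0, mul_zero]
  -- Unitary invariance carries the property from the one frame `O` to the given frame: `Oᴴ (Q V) =
  -- Zᴴ V` when `Q Z = O`.
  obtain ⟨Q, hQ, hQZ⟩ := exists_unitary_mul_eq hZ hO
  have hQQ : Qᴴ * Q = 1 := Matrix.mem_unitaryGroup_iff'.1 hQ
  have := (measurePreserving_mul_stiefelUniform (k := k) hQ).quasiMeasurePreserving.ae hOV
  refine this.mono fun V hV => ?_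
  rwa [← hQZ, Matrix.conjTranspose_mul, Matrix.mul_assoc, ← Matrix.mul_assoc Qᴴ, hQQ,
    Matrix.one_mul] at hV

end Generic

end SingularPencil

namespace SingularPencil

section NullDirection

variable {𝕜 : Type*} [RCLike 𝕜] {n k : ℕ}

/-! ### The null direction of a `k × (k + 1)` matrix -/

/-- The vector of signed maximal minors of `G`. -/
noncomputable def minorVector (G : Matrix (Fin k) (Fin k ⊕ Unit) 𝕜) :
    EuclideanSpace 𝕜 (Fin k ⊕ Unit) :=
  WithLp.toLp 2 fun j =>
    (Matrix.fromRows G (0 : Matrix Unit (Fin k ⊕ Unit) 𝕜)).adjugate j (Sum.inr ())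

/-- The normalized vector of signed maximal minors of `G`. -/
noncomputable def nullDirection (G : Matrix (Fin k) (Fin k ⊕ Unit) 𝕜) :
    EuclideanSpace 𝕜 (Fin k ⊕ Unit) :=
  ((‖minorVector G‖ : 𝕜)⁻¹) • minorVector G

/-- Bordering `G` by a zero row gives a singular square matrix, and its product with its adjugate
vanishes. The column of cofactors used does not involve the added row. -/
lemma mulVec_minorVector (G : Matrix (Fin k) (Fin k ⊕ Unit) 𝕜) : G *ᵥ (minorVector G).ofLp = 0 := by
  set A := Matrix.fromRows G (0 : Matrix Unit (Fin k ⊕ Unit) 𝕜) with hA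
  have hdet : A.det = 0 := Matrix.det_eq_zero_of_row_eq_zero (Sum.inr ()) fun j => rfl
  have h := A.mul_adjugate
  rw [hdet, zero_smul] at h
  ext i
  exact congrFun (congrFun h (Sum.inl i)) (Sum.inr ())

/-- Invertibility of the first `k` columns therefore makes the minor vector nonzero. -/
lemma minorVector_inr (G : Matrix (Fin k) (Fin k ⊕ Unit) 𝕜) :
    minorVector G (Sum.inr ()) = G.toCols₁.det := by
  have h : (Matrix.fromRows G (0 : Matrix Unit (Fin k ⊕ Unit) 𝕜)).updateRow (Sum.inr ())
      (Pi.single (Sum.inr ()) 1) = Matrix.fromBlocks G.toCols₁ G.toCols₂ 0 1 := by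
    ext (i | i) (j | j) <;> simp [Matrix.updateRow_apply, Matrix.toCols₁, Matrix.toCols₂]
  change (Matrix.fromRows G (0 : Matrix Unit (Fin k ⊕ Unit) 𝕜)).adjugate (Sum.inr ()) (Sum.inr ()) = _
  rw [Matrix.adjugate_apply, h, Matrix.det_fromBlocks_zero₂₁, Matrix.det_one, mul_one]

lemma mulVec_nullDirection (G : Matrix (Fin k) (Fin k ⊕ Unit) 𝕜) :
    G *ᵥ (nullDirection G).ofLp = 0 := by
  rw [nullDirection, WithLp.ofLp_smul, Matrix.mulVec_smul, mulVec_minorVector, smul_zero]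

lemma norm_nullDirection {G : Matrix (Fin k) (Fin k ⊕ Unit) 𝕜} (hG : G.toCols₁.det ≠ 0) :
    ‖nullDirection G‖ = 1 := by
  refine norm_smul_inv_norm fun h => hG ?_
  rw [← minorVector_inr, h]
  rfl

/-- The minors are polynomials in the entries, so this choice of kernel vector is measurable without
a selection argument. -/
lemma measurable_nullDirection :
    Measurable (nullDirection : Matrix (Fin k) (Fin k ⊕ Unit) 𝕜 → _) := by
  have h : Continuous (minorVector : Matrix (Fin k) (Fin k ⊕ Unit) 𝕜 → _) := by
    refine (PiLp.continuous_toLp 2 _).comp (continuous_pi fun j => ?_)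
    refine Continuous.matrix_elem (Continuous.matrix_adjugate ?_) _ _
    refine continuous_matrix fun i j => ?_
    rcases i with i | i
    · exact continuous_id.matrix_elem i j
    · exact continuous_const
  have hm := h.measurable
  have hn : Measurable fun G : Matrix (Fin k) (Fin k ⊕ Unit) 𝕜 => ((‖minorVector G‖ : 𝕜)⁻¹) :=
    (RCLike.measurable_ofReal.comp hm.norm).inv
  exact hn.smul hm

/-- With the first `k` columns invertible, a kernel vector is determined by its last coordinate, so
the kernel is a line. -/
lemma exists_eq_smul_nullDirection {G : Matrix (Fin k) (Fin k ⊕ Unit) 𝕜}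
    (hG : G.toCols₁.det ≠ 0) {c : EuclideanSpace 𝕜 (Fin k ⊕ Unit)} (hc : G *ᵥ c.ofLp = 0)
    (hc1 : ‖c‖ = 1) : ∃ a : 𝕜, ‖a‖ = 1 ∧ c = a • nullDirection G := by
  set d := nullDirection G with hd
  have hd1 : ‖d‖ = 1 := norm_nullDirection hG
  have hzero : ∀ v : EuclideanSpace 𝕜 (Fin k ⊕ Unit), G *ᵥ v.ofLp = 0 → v (Sum.inr ()) = 0 →
      v = 0 := fun v hv h0 => by
    have h1 : G.toCols₁ *ᵥ (fun i => v (Sum.inl i)) = 0 := by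
      rw [← hv]
      ext i
      simp [Matrix.mulVec, dotProduct, Matrix.toCols₁, h0]
    have h2 := Matrix.eq_zero_of_mulVec_eq_zero hG h1
    ext (i | i)
    · exact congrFun h2 i
    · exact h0
  have hd0 : d (Sum.inr ()) ≠ 0 := fun h => by
    rw [hzero d (mulVec_nullDirection G) h, norm_zero] at hd1
    exact zero_ne_one hd1
  have hcd : c = (c (Sum.inr ()) / d (Sum.inr ())) • d := by
    refine sub_eq_zero.1 (hzero _ ?_ ?_)
    · rw [WithLp.ofLp_sub, WithLp.ofLp_smul, Matrix.mulVec_sub, Matrix.mulVec_smul, hc,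
        mulVec_nullDirection, smul_zero, sub_zero]
    · simp [hd0]
  refine ⟨_, ?_, hcd⟩
  have h := hc1
  rwa [hcd, norm_smul, hd1, mul_one] at h

/-! ### Random frames -/

/-- The matrix `[X₁ x]`. -/
abbrev appendCol (X₁ : Matrix (Fin n) (Fin k) 𝕜) (x : Fin n → 𝕜) :
    Matrix (Fin n) (Fin k ⊕ Unit) 𝕜 :=
  Matrix.fromCols X₁ (Matrix.replicateCol Unit x)

lemma conjTranspose_mul_self_of_appendCol {X₁ : Matrix (Fin n) (Fin k) 𝕜} {x : Fin n → 𝕜}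
    (hX : (appendCol X₁ x)ᴴ * appendCol X₁ x = 1) : X₁ᴴ * X₁ = 1 := by
  ext i j
  have h := congrFun (congrFun hX (Sum.inl i)) (Sum.inl j)
  simp only [Matrix.one_apply, Sum.inl_injective.eq_iff] at h
  rw [Matrix.one_apply]
  exact h

lemma ae_det_toCols₁_ne_zero {X₁ : Matrix (Fin n) (Fin k) 𝕜} {x : Fin n → 𝕜}
    (hX : (appendCol X₁ x)ᴴ * appendCol X₁ x = 1) :
    ∀ᵐ V ∂stiefelUniform 𝕜 n k, (Vᴴ * appendCol X₁ x).toCols₁.det ≠ 0 := by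
  refine (ae_det_conjTranspose_mul_stiefelUniform_ne_zero
    (conjTranspose_mul_self_of_appendCol hX)).mono fun V hV => ?_
  rw [Matrix.mul_fromCols, Matrix.toCols₁_fromCols]
  rwa [← star_ne_zero, ← Matrix.det_conjTranspose, Matrix.conjTranspose_mul,
    Matrix.conjTranspose_conjTranspose] at hV

lemma measurable_nullDirection_conjTranspose_mul (X : Matrix (Fin n) (Fin k ⊕ Unit) 𝕜) :
    Measurable fun V : Matrix (Fin n) (Fin k) 𝕜 => nullDirection (Vᴴ * X) := by
  refine measurable_nullDirection.comp (measurable_pi_iff.2 fun i => measurable_pi_iff.2 fun j => ?_)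
  have : Continuous fun V : Matrix (Fin n) (Fin k) 𝕜 => (Vᴴ * X) i j :=
    (Continuous.matrix_mul (Continuous.matrix_conjTranspose continuous_id)
      continuous_const).matrix_elem i j
  exact this.measurable

/-- The law of the last coordinate of the null direction of `Vᴴ [X₁ x]`, where `[X₁ x]` has
orthonormal columns and `V` is uniformly distributed on the Stiefel manifold. -/
theorem map_norm_nullDirection_eq_gb1Measure (hk : 1 ≤ k) {X₁ : Matrix (Fin n) (Fin k) 𝕜}
    {x : Fin n → 𝕜} (hX : (appendCol X₁ x)ᴴ * appendCol X₁ x = 1) :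
    (stiefelUniform 𝕜 n k).map (fun V => ‖nullDirection (Vᴴ * appendCol X₁ x) (Sum.inr ())‖) =
      gb1Measure 2 1 (Module.finrank ℝ 𝕜 / 2) (Module.finrank ℝ 𝕜 * k / 2) := by
  set X := appendCol X₁ x with hXdef
  have hc := measurable_nullDirection_conjTranspose_mul (k := k) X
  have hgood := ae_det_toCols₁_ne_zero hX
  refine map_norm_inner_eq_gb1Measure hk _ hc (hgood.mono fun V hV => norm_nullDirection hV)
    fun u hu => ?_
  set e : EuclideanSpace 𝕜 (Fin k ⊕ Unit) := EuclideanSpace.single (Sum.inr ()) 1 with he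
  have hcol : ∀ v : EuclideanSpace 𝕜 (Fin k ⊕ Unit), ‖v‖ = 1 →
      (Matrix.replicateCol Unit v.ofLp)ᴴ * Matrix.replicateCol Unit v.ofLp = 1 := fun v hv => by
    ext i j
    have h : inner 𝕜 v v = 1 := by
      rw [inner_self_eq_norm_sq_to_K, hv]
      simp
    rw [EuclideanSpace.inner_eq_star_dotProduct, dotProduct_comm] at h
    simpa [Matrix.mul_apply, dotProduct] using h
  obtain ⟨W, hW, hWe⟩ := exists_unitary_mul_eq (hcol e (by simp [he])) (hcol u hu)
  have hWW : Wᴴ * W = 1 := Matrix.mem_unitaryGroup_iff'.1 hW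
  have hWe' : W *ᵥ e.ofLp = u.ofLp := by
    ext i
    exact congrFun (congrFun hWe i) ()
  -- A rotation `W` of the coordinates in the basis `X` is realized by a rotation `Q` of the ambient
  -- space, which the law of `V` does not see.
  obtain ⟨Q, hQ, hQX⟩ := exists_unitary_mul_eq (M := X) (N := X * W) hX (by
    rw [Matrix.conjTranspose_mul, Matrix.mul_assoc, ← Matrix.mul_assoc Xᴴ, hX, Matrix.one_mul, hWW])
  have hQ' : Qᴴ ∈ Matrix.unitaryGroup (Fin n) 𝕜 := Unitary.star_mem hQ
  have hmp := measurePreserving_mul_stiefelUniform (k := k) hQ'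
  have hnorm : Measurable fun V : Matrix (Fin n) (Fin k) 𝕜 =>
      ‖nullDirection (Vᴴ * X) (Sum.inr ())‖ :=
    ((EuclideanSpace.proj (𝕜 := 𝕜) (Sum.inr () : Fin k ⊕ Unit)).continuous.measurable.comp hc).norm
  conv_rhs => rw [← hmp.map_eq, Measure.map_map hnorm hmp.measurable]
  refine Measure.map_congr ?_
  filter_upwards [hgood, hmp.quasiMeasurePreserving.ae hgood] with V hV hV'
  have hG : (Qᴴ * V)ᴴ * X = Vᴴ * X * W := by
    rw [Matrix.conjTranspose_mul, Matrix.conjTranspose_conjTranspose, Matrix.mul_assoc, hQX,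
      Matrix.mul_assoc]
  set c := nullDirection ((Qᴴ * V)ᴴ * X) with hcdef
  have hc0 : ((Qᴴ * V)ᴴ * X) *ᵥ c.ofLp = 0 := mulVec_nullDirection _
  have hc1 : ‖c‖ = 1 := norm_nullDirection hV'
  -- `W c` spans the kernel of `Vᴴ X`, and its inner product with `u = W e` is the last coordinate
  -- of `c`; the phase `a` disappears in the norm.
  obtain ⟨a, ha, hac⟩ := exists_eq_smul_nullDirection hV (c := WithLp.toLp 2 (W *ᵥ c.ofLp))
    (by rw [← hc0, hG, Matrix.mulVec_mulVec]) (by rw [norm_toLp_mulVec hWW]; exact hc1)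
  have h1 : inner 𝕜 u (WithLp.toLp 2 (W *ᵥ c.ofLp)) = c (Sum.inr ()) := by
    rw [EuclideanSpace.inner_eq_star_dotProduct, ← hWe', Matrix.star_mulVec, dotProduct_comm,
      ← Matrix.dotProduct_mulVec, Matrix.mulVec_mulVec, hWW, Matrix.one_mulVec]
    simp [he, dotProduct]
  rw [hac, inner_smul_right] at h1
  rw [Function.comp_apply, ← hcdef, ← h1, norm_mul, ha, one_mul]

end NullDirection

/-! ### Null vectors of a randomly modified matrix -/

section ModifiedMatrix

variable {𝕜 : Type*} [RCLike 𝕜] {n k : ℕ} {Ω : Type*} [MeasurableSpace Ω] {P : Measure Ω}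
  {X₁ Y₁ : Matrix (Fin n) (Fin k) 𝕜} {x y : Fin n → 𝕜} {C : Matrix (Fin n) (Fin n) 𝕜}
  {U V : Ω → Matrix (Fin n) (Fin k) 𝕜} {E : Ω → Matrix (Fin k) (Fin k) 𝕜} {v : Ω → Fin n → 𝕜}

/-- Multiplication by `Y₁ᴴ` removes `C`, and the remaining square factors `Y₁ᴴ U` and `E` can be
cancelled. -/
lemma ae_mulVec_eq_zero_of_modified (hY : (appendCol Y₁ y)ᴴ * appendCol Y₁ y = 1)
    (hYC : (appendCol Y₁ y)ᴴ * C = 0) (hU : HasLaw U (stiefelUniform 𝕜 n k) P)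
    (hE : ∀ᵐ ω ∂P, (E ω).det ≠ 0)
    (hv : ∀ᵐ ω ∂P, (C + U ω * E ω * (V ω)ᴴ) *ᵥ v ω = 0) :
    ∀ᵐ ω ∂P, C *ᵥ v ω = 0 ∧ (V ω)ᴴ *ᵥ v ω = 0 := by
  have hY₁C : Y₁ᴴ * C = 0 := by
    ext i j
    exact congrFun (congrFun hYC (Sum.inl i)) j
  have hgood : ∀ᵐ ω ∂P, (Y₁ᴴ * U ω).det ≠ 0 := by
    have h := ae_det_conjTranspose_mul_stiefelUniform_ne_zero (conjTranspose_mul_self_of_appendCol hY)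
    rw [← hU.map_eq] at h
    exact ae_of_ae_map hU.aemeasurable h
  filter_upwards [hgood, hE, hv] with ω h1 h2 h3
  have h4 : (V ω)ᴴ *ᵥ v ω = 0 := by
    refine Matrix.eq_zero_of_mulVec_eq_zero h2 (Matrix.eq_zero_of_mulVec_eq_zero h1 ?_)
    have h5 := congrArg (fun w => Y₁ᴴ *ᵥ w) h3
    simpa [Matrix.mulVec_mulVec, Matrix.mul_add, hY₁C, ← Matrix.mul_assoc] using h5
  refine ⟨?_, h4⟩
  rwa [Matrix.add_mulVec, ← Matrix.mulVec_mulVec, h4, Matrix.mulVec_zero, add_zero] at h3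

/-- Unit null vectors of `C + U E Vᴴ`, with `U` and `V` uniformly distributed on the Stiefel
manifold and `E` nonsingular, where `[X₁ x]` and `[Y₁ y]` are orthonormal bases of the
`(k + 1)`-dimensional right and left null spaces of `C`. -/
theorem coeffAlong_of_modified (hk : 1 ≤ k)
    (hX : (appendCol X₁ x)ᴴ * appendCol X₁ x = 1)
    (hXC : LinearMap.range (appendCol X₁ x).mulVecLin = LinearMap.ker C.mulVecLin)
    (hY : (appendCol Y₁ y)ᴴ * appendCol Y₁ y = 1)
    (hYC : (appendCol Y₁ y)ᴴ * C = 0) (hU : HasLaw U (stiefelUniform 𝕜 n k) P)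
    (hV : HasLaw V (stiefelUniform 𝕜 n k) P) (hE : ∀ᵐ ω ∂P, (E ω).det ≠ 0)
    (hv : ∀ᵐ ω ∂P, (C + U ω * E ω * (V ω)ᴴ) *ᵥ v ω = 0)
    (hv1 : ∀ᵐ ω ∂P, ‖WithLp.toLp 2 (v ω)‖ = 1) :
    (∀ᵐ ω ∂P, (∃ a, v ω = X₁ *ᵥ a + coeffAlong x (v ω) • x) ∧ (V ω)ᴴ *ᵥ v ω = 0) ∧
    HasLaw (fun ω => ‖coeffAlong x (v ω)‖)
      (gb1Measure 2 1 (Module.finrank ℝ 𝕜 / 2) (Module.finrank ℝ 𝕜 * k / 2)) P := by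
  have hnull := ae_mulVec_eq_zero_of_modified hY hYC hU hE hv
  have hcoord : ∀ w : Fin n → 𝕜, C *ᵥ w = 0 → ∃ c : Fin k ⊕ Unit → 𝕜,
      w = appendCol X₁ x *ᵥ c ∧ coeffAlong x w = c (Sum.inr ()) := by
    intro w hw
    have hw' : w ∈ LinearMap.range (appendCol X₁ x).mulVecLin := by
      rw [hXC]
      exact hw
    obtain ⟨c, rfl⟩ := hw'
    refine ⟨c, rfl, ?_⟩
    have h : ((appendCol X₁ x)ᴴ *ᵥ (appendCol X₁ x *ᵥ c)) (Sum.inr ()) = c (Sum.inr ()) := by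
      rw [Matrix.mulVec_mulVec, hX, Matrix.one_mulVec]
    exact h
  refine ⟨hnull.mono fun ω hω => ⟨?_, hω.2⟩, ?_⟩
  · obtain ⟨c, hc, hcx⟩ := hcoord _ hω.1
    refine ⟨c ∘ Sum.inl, ?_⟩
    rw [hcx]
    nth_rw 1 [hc]
    rw [Matrix.fromCols_mulVec]
    congr 1
    ext i
    simp [Matrix.mulVec, dotProduct, mul_comm]
  · have hgood : ∀ᵐ ω ∂P, ((V ω)ᴴ * appendCol X₁ x).toCols₁.det ≠ 0 := by
      have h := ae_det_toCols₁_ne_zero hX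
      rw [← hV.map_eq] at h
      exact ae_of_ae_map hV.aemeasurable h
    have hlaw : HasLaw (fun V : Matrix (Fin n) (Fin k) 𝕜 =>
        ‖nullDirection (Vᴴ * appendCol X₁ x) (Sum.inr ())‖)
        (gb1Measure 2 1 (Module.finrank ℝ 𝕜 / 2) (Module.finrank ℝ 𝕜 * k / 2))
        (stiefelUniform 𝕜 n k) :=
      ⟨(((EuclideanSpace.proj (𝕜 := 𝕜) (Sum.inr () : Fin k ⊕ Unit)).continuous.measurable.comp
        (measurable_nullDirection_conjTranspose_mul _)).norm).aemeasurable,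
        map_norm_nullDirection_eq_gb1Measure hk hX⟩
    -- The coefficient agrees almost surely with a measurable function of `V`, which yields its
    -- measurability as well as its law.
    refine (hlaw.comp hV).congr ?_
    filter_upwards [hgood, hnull, hv1] with ω h1 h2 h3
    obtain ⟨c, hc, hcx⟩ := hcoord _ h2.1
    obtain ⟨a, ha, hac⟩ := exists_eq_smul_nullDirection h1 (c := WithLp.toLp 2 c)
      (by rw [← h2.2, hc, Matrix.mulVec_mulVec]) (by rw [← h3, hc, norm_toLp_mulVec hX])
    have h4 : c (Sum.inr ()) = a * nullDirection ((V ω)ᴴ * appendCol X₁ x) (Sum.inr ()) :=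
      congrArg (fun w : EuclideanSpace 𝕜 (Fin k ⊕ Unit) => w (Sum.inr ())) hac
    rw [hcx, h4, norm_mul, ha, one_mul]
    rfl

end ModifiedMatrix

/-! ### Right and left eigenvectors of the modified pencil -/

section Setting

variable {𝕜 : Type*} [RCLike 𝕜] {n k : ℕ} {Ω : Type*} [MeasurableSpace Ω] {P : Measure Ω}
  {A B : Matrix (Fin n) (Fin n) 𝕜} {lam : 𝕜} {X₁ Y₁ : Matrix (Fin n) (Fin k) 𝕜}
  {x y : Fin n → 𝕜} {τ : 𝕜} {dA dB : Ω → Fin k → 𝕜} {U V : Ω → Matrix (Fin n) (Fin k) 𝕜}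
  {xi yi : Ω → Fin n → 𝕜}

lemma modified_sub_smul_modified (A B : Matrix (Fin n) (Fin n) 𝕜) (lam τ : 𝕜)
    (U V : Matrix (Fin n) (Fin k) 𝕜) (dA dB : Fin k → 𝕜) :
    modified A τ U V dA - lam • modified B τ U V dB = (A - lam • B) +
      U * (τ • (Matrix.diagonal dA - lam • Matrix.diagonal dB)) * Vᴴ := by
  simp only [modified, Matrix.mul_smul, Matrix.smul_mul, Matrix.mul_sub, Matrix.sub_mul, smul_add,
    smul_sub, smul_comm τ lam]
  abel

lemma conjTranspose_mul_eq_zero_of_range_eq_ker {ι : Type*} [Fintype ι] [DecidableEq ι]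
    {M : Matrix (Fin n) ι 𝕜} {C : Matrix (Fin n) (Fin n) 𝕜}
    (h : LinearMap.range M.mulVecLin = LinearMap.ker C.mulVecLin) : Mᴴ * Cᴴ = 0 := by
  have h1 : C * M = 0 := by
    refine Matrix.ext_of_mulVec_single fun i => ?_
    have h2 : M *ᵥ Pi.single i 1 ∈ LinearMap.ker C.mulVecLin := by
      rw [← h]
      exact ⟨_, rfl⟩
    rw [← Matrix.mulVec_mulVec, Matrix.zero_mulVec]
    exact h2
  rw [← Matrix.conjTranspose_mul, h1, Matrix.conjTranspose_zero]

theorem Setting.right (S : Setting P A B lam X₁ x Y₁ y τ dA dB U V xi yi) :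
    (∀ᵐ ω ∂P, (∃ a, xi ω = X₁ *ᵥ a + coeffAlong x (xi ω) • x) ∧ (V ω)ᴴ *ᵥ xi ω = 0) ∧
    HasLaw (fun ω => ‖coeffAlong x (xi ω)‖)
      (gb1Measure 2 1 (Module.finrank ℝ 𝕜 / 2) (Module.finrank ℝ 𝕜 * k / 2)) P := by
  refine coeffAlong_of_modified S.one_le_k S.right_basis.orthonormal S.right_basis.range_X
    S.left_basis.orthonormal ?_ S.law_U S.law_V
    (E := fun ω => τ • (Matrix.diagonal (dA ω) - lam • Matrix.diagonal (dB ω))) ?_ ?_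
    (S.right_eigenvector.mono fun ω h => h.2)
  · have h := conjTranspose_mul_eq_zero_of_range_eq_ker S.left_basis.range_X
    rwa [Matrix.conjTranspose_sub, Matrix.conjTranspose_smul, star_star,
      Matrix.conjTranspose_conjTranspose, Matrix.conjTranspose_conjTranspose] at h
  · refine S.nonsingular.mono fun ω h => ?_
    rw [Matrix.det_smul]
    exact mul_ne_zero (pow_ne_zero _ S.tau_ne_zero) h
  · refine S.right_eigenvector.mono fun ω h => ?_
    rw [← modified_sub_smul_modified]
    exact h.1

/-- The adjoint of `C + U E Vᴴ` is `Cᴴ + V Eᴴ Uᴴ`, of the same shape with `U`, `V` and the two bases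
exchanged. -/
theorem Setting.left (S : Setting P A B lam X₁ x Y₁ y τ dA dB U V xi yi) :
    (∀ᵐ ω ∂P, (∃ b, yi ω = Y₁ *ᵥ b + coeffAlong y (yi ω) • y) ∧ (U ω)ᴴ *ᵥ yi ω = 0) ∧
    HasLaw (fun ω => ‖coeffAlong y (yi ω)‖)
      (gb1Measure 2 1 (Module.finrank ℝ 𝕜 / 2) (Module.finrank ℝ 𝕜 * k / 2)) P := by
  have hC : Aᴴ - star lam • Bᴴ = (A - lam • B)ᴴ := by
    rw [Matrix.conjTranspose_sub, Matrix.conjTranspose_smul]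
  refine coeffAlong_of_modified S.one_le_k S.left_basis.orthonormal S.left_basis.range_X
    S.right_basis.orthonormal ?_ S.law_V S.law_U
    (E := fun ω => (τ • (Matrix.diagonal (dA ω) - lam • Matrix.diagonal (dB ω)))ᴴ) ?_ ?_
    (S.left_eigenvector.mono fun ω h => h.2)
  · rw [hC]
    exact conjTranspose_mul_eq_zero_of_range_eq_ker S.right_basis.range_X
  · refine S.nonsingular.mono fun ω h => ?_
    rw [Matrix.det_conjTranspose, Matrix.det_smul, star_ne_zero]
    exact mul_ne_zero (pow_ne_zero _ S.tau_ne_zero) h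
  · refine S.left_eigenvector.mono fun ω h => ?_
    have h2 := congrArg Matrix.conjTranspose
      (modified_sub_smul_modified A B lam τ (U ω) (V ω) (dA ω) (dB ω))
    rw [Matrix.conjTranspose_sub, Matrix.conjTranspose_smul, Matrix.conjTranspose_add,
      Matrix.conjTranspose_mul, Matrix.conjTranspose_mul, Matrix.conjTranspose_conjTranspose,
      ← Matrix.mul_assoc, ← hC] at h2
    rw [← h2]
    exact h.1

end Setting

end SingularPencil


theorem lemmaA1 {Ω : Type*} [MeasurableSpace Ω] (P : Measure Ω) [IsProbabilityMeasure P]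
    {n k : ℕ} :
    -- complex case
    (∀ (A B : Matrix (Fin n) (Fin n) ℂ) (lam : ℂ)
        (X₁ : Matrix (Fin n) (Fin k) ℂ) (x : Fin n → ℂ)
        (Y₁ : Matrix (Fin n) (Fin k) ℂ) (y : Fin n → ℂ)
        (τ : ℂ) (dA dB : Ω → Fin k → ℂ) (U V : Ω → Matrix (Fin n) (Fin k) ℂ)
        (xi yi : Ω → Fin n → ℂ) (α β : Ω → ℂ),
      SingularPencil.Setting P A B lam X₁ x Y₁ y τ dA dB U V xi yi →
      (∀ ω, α ω = SingularPencil.coeffAlong x (xi ω)) →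
      (∀ ω, β ω = SingularPencil.coeffAlong y (yi ω)) →
      (∀ᵐ ω ∂P, (∃ a, xi ω = X₁ *ᵥ a + α ω • x) ∧ (V ω)ᴴ *ᵥ xi ω = 0) ∧
      (∀ᵐ ω ∂P, (∃ b, yi ω = Y₁ *ᵥ b + β ω • y) ∧ (U ω)ᴴ *ᵥ yi ω = 0) ∧
      HasLaw (fun ω => ‖α ω‖) (SingularPencil.gb1Measure 2 1 1 k) P ∧
      HasLaw (fun ω => ‖β ω‖) (SingularPencil.gb1Measure 2 1 1 k) P ∧
      SingularPencil.gb1Measure 2 1 1 k = SingularPencil.kumaraswamyMeasure 2 k ∧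
      SingularPencil.kumaraswamyMeasure 2 k =
        volume.withDensity (fun t : ℝ => ENNReal.ofReal
          ((Set.Ioo (0 : ℝ) 1).indicator
            (fun t => 2 * (k : ℝ) * t * (1 - t ^ 2) ^ (k - 1)) t))) ∧
    -- real case
    (∀ (A B : Matrix (Fin n) (Fin n) ℝ) (lam : ℝ)
        (X₁ : Matrix (Fin n) (Fin k) ℝ) (x : Fin n → ℝ)
        (Y₁ : Matrix (Fin n) (Fin k) ℝ) (y : Fin n → ℝ)
        (τ : ℝ) (dA dB : Ω → Fin k → ℝ) (U V : Ω → Matrix (Fin n) (Fin k) ℝ)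
        (xi yi : Ω → Fin n → ℝ) (α β : Ω → ℝ),
      SingularPencil.Setting P A B lam X₁ x Y₁ y τ dA dB U V xi yi →
      (∀ ω, α ω = SingularPencil.coeffAlong x (xi ω)) →
      (∀ ω, β ω = SingularPencil.coeffAlong y (yi ω)) →
      (∀ᵐ ω ∂P, (∃ a, xi ω = X₁ *ᵥ a + α ω • x) ∧ (V ω)ᴴ *ᵥ xi ω = 0) ∧
      (∀ᵐ ω ∂P, (∃ b, yi ω = Y₁ *ᵥ b + β ω • y) ∧ (U ω)ᴴ *ᵥ yi ω = 0) ∧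
      HasLaw (fun ω => |α ω|) (SingularPencil.gb1Measure 2 1 (1 / 2) (k / 2)) P ∧
      HasLaw (fun ω => |β ω|) (SingularPencil.gb1Measure 2 1 (1 / 2) (k / 2)) P ∧
      SingularPencil.gb1Measure 2 1 (1 / 2) (k / 2) =
        volume.withDensity (fun t : ℝ => ENNReal.ofReal
          ((Set.Ioo (0 : ℝ) 1).indicator
            (fun t => 2 / beta (1 / 2) ((k : ℝ) / 2) *
              (1 - t ^ 2) ^ ((k : ℝ) / 2 - 1)) t))) := by
  constructor
  · intro A B lam X₁ x Y₁ y τ dA dB U V xi yi α β S hα hβ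
    obtain rfl : α = _ := funext hα
    obtain rfl : β = _ := funext hβ
    have hk : (0 : ℝ) < k := Nat.cast_pos.2 S.one_le_k
    obtain ⟨h1, h2⟩ := S.right
    obtain ⟨h3, h4⟩ := S.left
    -- Here `d = 2`, so the parameters `d / 2` and `d k / 2` become `1` and `k`.
    rw [Complex.finrank_real_complex, Nat.cast_ofNat, div_self two_ne_zero,
      mul_div_cancel_left₀ _ two_ne_zero] at h2 h4
    exact ⟨h1, h3, h2, h4, SingularPencil.gb1Measure_one_eq_kumaraswamyMeasure hk,
      SingularPencil.kumaraswamyMeasure_two_natCast S.one_le_k⟩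
  · intro A B lam X₁ x Y₁ y τ dA dB U V xi yi α β S hα hβ
    obtain rfl : α = _ := funext hα
    obtain rfl : β = _ := funext hβ
    obtain ⟨h1, h2⟩ := S.right
    obtain ⟨h3, h4⟩ := S.left
    rw [Module.finrank_self, Nat.cast_one, one_mul] at h2 h4
    exact ⟨h1, h3, h2, h4, SingularPencil.gb1Measure_half _⟩
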